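/- Notation. Let $p$ be a prime and $G$ a finite group. $\mathrm{Irr}(G)$ is the set of irreducible complex characters of $G$, $B_0(G)$ is the principal $p$-block of $G$ (the block containing the trivial character), and $k(G)$ is the number of conjugacy classes of $G$. A character is almost $p$-rational if its values lie in $\mathbb{Q}_n=\mathbb{Q}(e^{2\pi i/n})$ for some positive integer $n$ not divisible by $p^2$. Let $\mathrm{Irr}_{p'}(B_0(G))$ be the set of $\chi\in\mathrm{Irr}(G)\cap B_0(G)$ with $p\nmid\chi(1)$, and let $\mathrm{Irr}_{p',p\text{-arat}}(B_0(G))$ be the set of almost $p$-rational characters in it. Put $\mathcal{S}_p=\{e+\frac{p-1}{e} : e\in\mathbb{Z}^+,\ e\mid p-1\}$. Theorem. Assume that the following two statements hold. (a) For every prime $p$, every integer $n\ge 2$, every vector space $V$ over $\mathbb{F}_p$ of size $p^n$, and every finite group $H$ of order prime to $p$ acting faithfully and linearly on $V$, one has $k(HV)\notin\mathcal{S}_p$, where $HV$ is the semidirect product of $V$ by $H$. (b) (Principal block case of the Alperin--McKay--Navarro conjecture.) For every finite group $G$, every prime $p$ and every Sylow $p$-subgroup $P$ of $G$, there is a bijection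 $\mathrm{Irr}_{p'}(B_0(G))\to\mathrm{Irr}_{p'}(B_0(\mathbf{N}_G(P)))$ that commutes with the action of the group $\mathcal{H}$ of all $\sigma\in\mathrm{Gal}(\mathbb{Q}_{|G|}/\mathbb{Q})$ for which there is a power $q$ of $p$ such that $\sigma(\xi)=\xi^q$ for every root of unity $\xi\in\mathbb{Q}_{|G|}$ of order not divisible by $p$. Then for every finite group $G$ and every prime $p$ dividing $|G|$, the Sylow $p$-subgroups of $G$ are cyclic if and only if $|\mathrm{Irr}_{p',p\text{-arat}}(B_0(G))|\in\mathcal{S}_p$. -/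

import Mathlib

universe u

noncomputable section

namespace AlmostRational

/-- `Irr(G)`: the irreducible complex characters of `G`, i.e. the functions
`g ↦ trace (ρ g)` for the irreducible complex (matrix) representations `ρ` of `G`. -/
def Irr (G : Type*) [Group G] : Set (G → ℂ) :=
  {χ | ∃ (n : ℕ) (ρ : Representation ℂ G (Fin n → ℂ)), ρ.IsIrreducible ∧ ρ.character = χ}

/-- The degree `χ(1)` is (a natural number) not divisible by `p`. -/
def HasPrimeToDegree {G : Type*} [Group G] (p : ℕ) (χ : G → ℂ) : Prop :=
  ∃ d : ℕ, χ 1 = (d : ℂ) ∧ ¬ p ∣ d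

/-- The cyclotomic field `ℚ_n = ℚ(e^{2πi/n})`, as a subfield of `ℂ`. -/
abbrev cycField (n : ℕ) : IntermediateField ℚ ℂ :=
  IntermediateField.adjoin ℚ {Complex.exp (2 * Real.pi * Complex.I / n)}

/-- `χ` is almost `p`-rational: its values lie in `ℚ_n` for some positive integer `n` that is
divisible by `p` at most once. -/
def IsAlmostRational {G : Type*} (p : ℕ) (χ : G → ℂ) : Prop :=
  ∃ n : ℕ, 0 < n ∧ ¬ p ^ 2 ∣ n ∧ ∀ g, χ g ∈ cycField n

/-- The central character `ω_χ` evaluated at the sum of the conjugacy class `K` of `x`: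
`ω_χ(K⁺) = |K| χ(x) / χ(1)`. -/
def centralChar {G : Type*} [Group G] (χ : G → ℂ) (x : G) : ℂ :=
  (Nat.card (ConjClasses.mk x).carrier : ℂ) * χ x / χ 1

/-- `χ` and `ψ` lie in the same `p`-block: their central characters agree modulo the maximal
ideals over `p` of the ring of algebraic integers.  (All maximal ideals over `p` give the same
partition of `Irr(G)`, so that it does not matter whether one or all of them are used.) -/
def SameBlock {G : Type*} [Group G] (p : ℕ) (χ ψ : G → ℂ) : Prop :=
  ∀ M : Ideal (integralClosure ℤ ℂ), M.IsMaximal → (p : integralClosure ℤ ℂ) ∈ M →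
    ∀ x : G, ∃ a ∈ M, (a : ℂ) = centralChar χ x - centralChar ψ x

/-- The irreducible characters in the principal `p`-block `B₀(G)`, the block of the trivial
character. -/
def principalBlock (p : ℕ) (G : Type*) [Group G] : Set (G → ℂ) :=
  {χ | χ ∈ Irr G ∧ SameBlock p χ (fun _ => 1)}

/-- `Irr_{p'}(B₀(G))`: the characters of degree prime to `p` in the principal block.
They are its characters of height zero. -/
def primeToBlock (p : ℕ) (G : Type*) [Group G] : Set (G → ℂ) :=
  {χ | χ ∈ principalBlock p G ∧ HasPrimeToDegree p χ}

/-- The almost `p`-rational characters of degree prime to `p` in the principal block. -/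
def primeToRatBlock (p : ℕ) (G : Type*) [Group G] : Set (G → ℂ) :=
  {χ | χ ∈ primeToBlock p G ∧ IsAlmostRational p χ}

/-- `S_p = {e + (p-1)/e : e a positive divisor of p-1}`. -/
def cyclicSet (p : ℕ) : Set ℕ :=
  {s | ∃ e : ℕ, 0 < e ∧ e ∣ p - 1 ∧ s = e + (p - 1) / e}

/-- The class number `k(G)`. -/
def classNumber (G : Type*) [Group G] : ℕ := Nat.card (ConjClasses G)

/-- A linear action of `H` on the `𝔽_p`-space `V`, as an action on the multiplicatively written
group `V` by automorphisms. -/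
def affineAction {p : ℕ} {H V : Type*} [Group H] [AddCommGroup V] [Module (ZMod p) V]
    (φ : H →* (V ≃ₗ[ZMod p] V)) : H →* MulAut (Multiplicative V) where
  toFun h := AddEquiv.toMultiplicative (φ h).toAddEquiv
  map_one' := by rw [map_one]; rfl
  map_mul' a b := by rw [map_mul]; rfl

/-- The affirmative answer to the question on class numbers of affine groups: for every prime `p`
and every `p'`-group `H` acting faithfully on a vector space `V` of size `p ^ n` with `n ≥ 2`, the
class number of the semidirect product `HV` is not in `S_p`. -/
def AffineClassNumbers.{v} : Prop :=
  ∀ (p n : ℕ), p.Prime → 2 ≤ n →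
    ∀ (H V : Type v) [Group H] [Finite H] [AddCommGroup V] [Module (ZMod p) V]
      (φ : H →* (V ≃ₗ[ZMod p] V)), Function.Injective φ →
      ¬ p ∣ Nat.card H → Nat.card V = p ^ n →
      classNumber (Multiplicative V ⋊[affineAction φ] H) ∉ cyclicSet p

/-- The subgroup `𝓗` of `Gal(ℚ_m/ℚ)`: the automorphisms for which there is a power `q` of `p` such
that every root of unity of order not divisible by `p` is sent to its `q`-th power.
(`orderOf ξ = 0`, which `p` divides, if `ξ` is not a root of unity.) -/
def navarroGroup (p m : ℕ) : Set (cycField m ≃ₐ[ℚ] cycField m) :=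
  {σ | ∃ f : ℕ, ∀ ξ : cycField m, ¬ p ∣ orderOf ξ → σ ξ = ξ ^ p ^ f}

/-- `χ' = χ^σ`: the values of `χ` lie in `ℚ_m`, and `χ'(g) = σ(χ(g))` for all `g`. -/
def IsGaloisConj {G : Type*} {m : ℕ} (σ : cycField m ≃ₐ[ℚ] cycField m) (χ χ' : G → ℂ) : Prop :=
  ∀ g, ∃ z : cycField m, (z : ℂ) = χ g ∧ ((σ z : cycField m) : ℂ) = χ' g

/-- The principal block case of the Alperin–McKay–Navarro conjecture: for every finite group `G`,
every prime `p` and every Sylow `p`-subgroup `P` of `G` there is a bijection from `Irr_{p'}(B₀(G))`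
onto `Irr_{p'}(B₀(N_G(P)))` that commutes with the action of the subgroup `𝓗` of
`Gal(ℚ_{|G|}/ℚ)`. -/
def PrincipalBlockAMN.{v} : Prop :=
  ∀ (G : Type v) [Group G] [Finite G] (p : ℕ), p.Prime → ∀ P : Sylow p G,
    ∃ f : primeToBlock p G ≃ primeToBlock p (Subgroup.normalizer ((P : Subgroup G) : Set G)),
      ∀ σ ∈ navarroGroup p (Nat.card G), ∀ χ χ' : primeToBlock p G,
        IsGaloisConj σ χ.1 χ'.1 ↔ IsGaloisConj σ (f χ).1 (f χ').1

end AlmostRational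

end

/-! Fix a Sylow subgroup P and let N be its normalizer. If m is the p'-part of |G|, a character with
values in ℚ_|G| is almost p-rational exactly when Gal(ℚ_|G|/ℚ_{pm}) fixes it
(`isAlmostRational_iff`), and that Galois group lies in 𝓗 (`fixingRoots_subset_navarroGroup`). So
the bijection in (b) preserves almost p-rationality, and the count can be made in N
(`ncard_primeToRatBlock_normalizer`).

In N the centralizer of P is Z(P) × K, where K is a normal p'-subgroup of N. Let Φ be the Frattini
subgroup of P, here `commPowSubgroup`. The characters being counted are the inflations of all of
Irr(Y), Y = N/KΦ (`NormalSylowData.primeToRatBlock_eq`). Indeed, membership in the principal block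
forces K into the kernel. Almost rationality forces Φ into it: a Galois automorphism raising p-power
roots of unity to the power 1 + p fixes χ, so λ ↦ λ^(1+p) permutes the linear constituents of χ
restricted to P. These form one N-orbit of length prime to p, and the permutation has p-power order,
so some λ is fixed; then λ^p = 1, λ is trivial on Φ, and Φ acts trivially because it is normal in N.
Conversely, Y has a normal elementary abelian Sylow subgroup V = P/Φ of index e, so its characters
have degree prime to p and values in ℚ_{pe}, and a congruence of central characters puts their
inflations in the principal block.

The count is therefore k(Y). By coprime action V is its own centralizer in Y, and P is cyclic if and
only if |V| = p. When |V| = p, counting commuting pairs gives k(Y) = e + (p-1)/e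
(`classNumber_mem_cyclicSet`). When |V| ≥ p², Schur–Zassenhaus writes Y as an affine group with
faithful complement, and (a) applies (`classNumber_notMem_cyclicSet`). -/

noncomputable section

namespace AlmostRational

open Module

/-! ### Schur's lemma, integrality of characters, and degrees dividing the group order. -/

section Basics

variable {G : Type*} [Group G] {V : Type*} [AddCommGroup V] [Module ℂ V]

theorem isIrreducible_iff (ρ : Representation ℂ G V) :
    ρ.IsIrreducible ↔ Nontrivial V ∧
      ∀ W : Submodule ℂ V, (∀ g, ∀ w ∈ W, ρ g w ∈ W) → W = ⊥ ∨ W = ⊤ := by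
  constructor
  · intro h
    refine ⟨?_, fun W hW => ?_⟩
    · by_contra hV
      rw [not_nontrivial_iff_subsingleton] at hV
      obtain ⟨a, b, hab⟩ := exists_pair_ne (Subrepresentation ρ)
      exact hab (SetLike.ext fun x => by
        rw [Subsingleton.elim x 0]
        exact ⟨fun _ => b.toSubmodule.zero_mem, fun _ => a.toSubmodule.zero_mem⟩)
    · rcases h.eq_bot_or_eq_top ⟨W, fun g w hw => hW g w hw⟩ with h | h
      · exact Or.inl (congrArg Subrepresentation.toSubmodule h)
      · exact Or.inr (congrArg Subrepresentation.toSubmodule h)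
  · rintro ⟨hV, h⟩
    refine { exists_pair_ne := ⟨⊥, ⊤, fun h' => ?_⟩, eq_bot_or_eq_top := fun W => ?_ }
    · have h2 : (⊥ : Submodule ℂ V) = ⊤ := congrArg Subrepresentation.toSubmodule h'
      exact bot_ne_top h2
    · rcases h W.toSubmodule (fun g w hw => W.apply_mem_toSubmodule g hw) with h | h
      · exact Or.inl (Subrepresentation.toSubmodule_injective h)
      · exact Or.inr (Subrepresentation.toSubmodule_injective h)

theorem eq_smul_one_of_commute [FiniteDimensional ℂ V] {ρ : Representation ℂ G V}
    (hρ : ρ.IsIrreducible) (f : V →ₗ[ℂ] V) (hf : ∀ g v, f (ρ g v) = ρ g (f v)) :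
    ∃ c : ℂ, f = c • LinearMap.id := by
  obtain ⟨hV, h⟩ := (isIrreducible_iff ρ).1 hρ
  obtain ⟨c, hc⟩ := Module.End.exists_eigenvalue f
  refine ⟨c, ?_⟩
  rcases h (Module.End.eigenspace f c) (fun g w hw => by
    rw [Module.End.mem_eigenspace_iff] at hw ⊢
    rw [hf, hw, map_smul]) with h | h
  · exact absurd h hc
  · ext v
    have : v ∈ Module.End.eigenspace f c := h ▸ Submodule.mem_top
    simpa using Module.End.mem_eigenspace_iff.1 this

/-- The group ring over the algebraic integers is a finite module, so all its elements are integral;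
`c` is the image of one of them. -/
theorem isIntegral_of_sum_smul_eq [Fintype G] [Nontrivial V] (ρ : Representation ℂ G V)
    (a : G → integralClosure ℤ ℂ) (c : ℂ)
    (h : ∑ x, (a x : ℂ) • ρ x = c • LinearMap.id) : IsIntegral ℤ c := by
  let φ : MonoidAlgebra (integralClosure ℤ ℂ) G →ₐ[integralClosure ℤ ℂ] Module.End ℂ V :=
    MonoidAlgebra.lift _ _ _ ρ
  let z : MonoidAlgebra (integralClosure ℤ ℂ) G := ∑ x, MonoidAlgebra.single x (a x)
  have hz : IsIntegral (integralClosure ℤ ℂ) z := by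
    have : Module.Finite (integralClosure ℤ ℂ) (MonoidAlgebra (integralClosure ℤ ℂ) G) :=
      inferInstance
    exact Algebra.IsIntegral.isIntegral z
  have h1 : φ z = algebraMap ℂ (Module.End ℂ V) c := by
    rw [Algebra.algebraMap_eq_smul_one]
    refine Eq.trans ?_ h
    simp only [φ, z, map_sum, MonoidAlgebra.lift_single]
    rfl
  have h2 : IsIntegral (integralClosure ℤ ℂ) (algebraMap ℂ (Module.End ℂ V) c) :=
    h1 ▸ hz.map φ
  have h3 : IsIntegral (integralClosure ℤ ℂ) c :=
    (isIntegral_algebraMap_iff (algebraMap ℂ (Module.End ℂ V)).injective).1 h2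
  exact isIntegral_trans (R := ℤ) c h3

theorem exists_isCompl_stable [Finite G] (ρ : Representation ℂ G V)
    (W : Submodule ℂ V) (hW : ∀ g, ∀ w ∈ W, ρ g w ∈ W) :
    ∃ U : Submodule ℂ V, (∀ g, ∀ w ∈ U, ρ g w ∈ U) ∧ IsCompl W U := by
  have : NeZero (Nat.card G : ℂ) := ⟨Nat.cast_ne_zero.2 Nat.card_pos.ne'⟩
  have h : ρ.IsSemisimpleRepresentation := inferInstance
  obtain ⟨U, h2⟩ := h.exists_isCompl ⟨W, fun g w hw => hW g w hw⟩
  refine ⟨U.toSubmodule, fun g w hw => U.apply_mem_toSubmodule g hw, ?_⟩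
  constructor
  · rw [disjoint_iff]
    exact congrArg Subrepresentation.toSubmodule (disjoint_iff.1 h2.disjoint)
  · rw [codisjoint_iff]
    exact congrArg Subrepresentation.toSubmodule (codisjoint_iff.1 h2.codisjoint)

/-- The representation on an invariant subspace. -/
def restrictStable (ρ : Representation ℂ G V) (W : Submodule ℂ V)
    (hW : ∀ g, ∀ w ∈ W, ρ g w ∈ W) : Representation ℂ G W :=
  Subrepresentation.toRepresentation ⟨W, fun g w hw => hW g w hw⟩

@[simp]
theorem coe_restrictStable_apply (ρ : Representation ℂ G V) (W : Submodule ℂ V)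
    (hW : ∀ g, ∀ w ∈ W, ρ g w ∈ W) (g : G) (w : W) :
    ((restrictStable ρ W hW g w : W) : V) = ρ g w := rfl

theorem exists_roots_of_unity_sum [Finite G] [FiniteDimensional ℂ V] (ρ : Representation ℂ G V)
    (g : G) : ∃ s : Multiset ℂ, (s.card : ℂ) = ρ.character 1 ∧
      (∀ μ ∈ s, μ ^ orderOf g = 1) ∧ ρ.character g = s.sum := by
  have hs : (LinearMap.charpoly (ρ g)).Splits := IsAlgClosed.splits _
  refine ⟨(LinearMap.charpoly (ρ g)).roots, ?_, fun μ hμ => ?_,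
    Module.End.trace_eq_sum_roots_charpoly_of_splits hs⟩
  · rw [Representation.char_one, ← hs.natDegree_eq_card_roots, LinearMap.charpoly_natDegree]
  · have h1 := (Module.End.hasEigenvalue_iff_isRoot_charpoly (ρ g) μ).2
      (Polynomial.isRoot_of_mem_roots hμ)
    obtain ⟨v, hv⟩ := h1.exists_hasEigenvector
    have h2 := hv.pow_apply (orderOf g)
    rw [← map_pow, pow_orderOf_eq_one, map_one, Module.End.one_apply] at h2
    have h3 : (μ ^ orderOf g - 1) • v = 0 := by rw [sub_smul, one_smul, ← h2, sub_self]
    exact sub_eq_zero.1 ((smul_eq_zero.1 h3).resolve_right hv.2)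

theorem isIntegral_character [Finite G] [FiniteDimensional ℂ V] (ρ : Representation ℂ G V)
    (g : G) : IsIntegral ℤ (ρ.character g) := by
  obtain ⟨s, -, hs, h⟩ := exists_roots_of_unity_sum ρ g
  rw [h]
  exact IsIntegral.multiset_sum fun μ hμ =>
    IsIntegral.of_pow (orderOf_pos g) (by rw [hs μ hμ]; exact isIntegral_one)

theorem sum_character_mul_character_inv [Fintype G] [FiniteDimensional ℂ V]
    {ρ : Representation ℂ G V} (hρ : ρ.IsIrreducible) :
    ∑ g, ρ.character g * ρ.character g⁻¹ = Nat.card G := by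
  have : Invertible (Nat.card G : ℂ) := invertibleOfNonzero (by simp)
  have h := Representation.char_orthonormal ρ ρ
  rw [if_pos ⟨Representation.Equiv.refl ρ⟩] at h
  rw [inv_mul_eq_iff_eq_mul₀ (by simp)] at h
  simpa using h

/-- The operator ∑ χ(x⁻¹)ρ(x) commutes with `G`, hence is a scalar. Its trace is |G|, so the scalar
is |G|/χ(1), which is both rational and integral. -/
theorem finrank_dvd_card [Finite G] [FiniteDimensional ℂ V]
    {ρ : Representation ℂ G V} (hρ : ρ.IsIrreducible) : finrank ℂ V ∣ Nat.card G := by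
  have := Fintype.ofFinite G
  have hV := ((isIrreducible_iff ρ).1 hρ).1
  have hd : (finrank ℂ V : ℂ) ≠ 0 := by exact_mod_cast finrank_pos.ne'
  let a : G → integralClosure ℤ ℂ := fun x => ⟨ρ.character x⁻¹, isIntegral_character ρ _⟩
  obtain ⟨c, hc⟩ := eq_smul_one_of_commute hρ (∑ x, (a x : ℂ) • ρ x) (fun g v => by
    simp only [LinearMap.sum_apply, LinearMap.smul_apply, map_sum, map_smul, a]
    refine Fintype.sum_equiv (MulAut.conj g⁻¹).toEquiv _ _ fun x => ?_
    have h1 : ρ.character (g⁻¹ * x * g)⁻¹ = ρ.character x⁻¹ := by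
      rw [← Representation.char_conj ρ x⁻¹ g⁻¹]; congr 1; group
    simp only [MulEquiv.toEquiv_eq_coe, MulEquiv.coe_toEquiv, MulAut.conj_apply, inv_inv, h1]
    rw [← Module.End.mul_apply, ← Module.End.mul_apply, ← map_mul, ← map_mul]
    congr 3; group)
  have h1 := isIntegral_of_sum_smul_eq ρ a c hc
  have h2 : (Nat.card G : ℂ) = c * finrank ℂ V := by
    have := congrArg (LinearMap.trace ℂ V) hc
    rw [map_sum, map_smul, ← Module.End.one_eq_id, LinearMap.trace_one, smul_eq_mul] at this
    rw [← this, ← sum_character_mul_character_inv hρ]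
    refine Finset.sum_congr rfl fun x _ => ?_
    rw [map_smul, smul_eq_mul, mul_comm]; rfl
  have h3 : c = algebraMap ℚ ℂ ((Nat.card G : ℚ) / finrank ℂ V) := by
    rw [map_div₀, map_natCast, map_natCast, h2, mul_div_cancel_right₀ _ hd]
  rw [h3, isIntegral_algebraMap_iff (algebraMap ℚ ℂ).injective,
    IsIntegrallyClosed.isIntegral_iff] at h1
  obtain ⟨y, hy⟩ := h1
  have hd' : (finrank ℂ V : ℚ) ≠ 0 := by exact_mod_cast hd
  rw [eq_div_iff hd', eq_intCast] at hy
  have h4 : y * (finrank ℂ V : ℤ) = Nat.card G := by exact_mod_cast hy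
  exact_mod_cast Dvd.intro_left y h4

end Basics

/-! ### The number of irreducible characters equals the class number. -/

section Counting

variable {G : Type*} [Group G]

theorem character_mem_Irr {V : Type*} [AddCommGroup V] [Module ℂ V] [FiniteDimensional ℂ V]
    {ρ : Representation ℂ G V} (hρ : ρ.IsIrreducible) : ρ.character ∈ Irr G := by
  let e : V ≃ₗ[ℂ] (Fin (finrank ℂ V) → ℂ) := (finBasis ℂ V).equivFun
  let ρ' : Representation ℂ G (Fin (finrank ℂ V) → ℂ) :=
    { toFun := fun g => e.conj (ρ g)
      map_one' := by rw [map_one]; exact e.conj_id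
      map_mul' := fun a b => by rw [map_mul]; exact e.conj_comp _ _ }
  have hρ' : ∀ g w, ρ' g w = e (ρ g (e.symm w)) := fun g w => rfl
  obtain ⟨hV, h⟩ := (isIrreducible_iff ρ).1 hρ
  refine ⟨_, ρ', (isIrreducible_iff ρ').2 ⟨e.symm.toEquiv.nontrivial, fun W hW => ?_⟩, ?_⟩
  · rcases h (W.comap (e : V →ₗ[ℂ] _)) (fun g w hw => by
      have := hW g _ hw
      rw [hρ'] at this
      simpa using this) with h | h
    · left
      rw [eq_bot_iff]
      intro w hw
      have : e.symm w ∈ W.comap (e : V →ₗ[ℂ] _) := by simpa using hw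
      rw [h, Submodule.mem_bot] at this
      simpa using this
    · right
      rw [eq_top_iff]
      intro w _
      have : e.symm w ∈ W.comap (e : V →ₗ[ℂ] _) := h ▸ Submodule.mem_top
      simpa using this
  · ext g
    exact LinearMap.trace_conj' (ρ g) e

theorem irr_conj {χ : G → ℂ} (hχ : χ ∈ Irr G) {a b : G} (h : IsConj a b) : χ a = χ b := by
  obtain ⟨n, ρ, -, rfl⟩ := hχ
  obtain ⟨c, rfl⟩ := isConj_iff.1 h
  rw [Representation.char_conj]

theorem sum_mul_inv_of_mem_Irr [Fintype G] {χ ψ : G → ℂ} (hχ : χ ∈ Irr G) (hψ : ψ ∈ Irr G) :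
    ∑ g, χ g * ψ g⁻¹ = if χ = ψ then (Nat.card G : ℂ) else 0 := by
  classical
  obtain ⟨n, ρ, hρ, rfl⟩ := hχ
  obtain ⟨m, σ, hσ, rfl⟩ := hψ
  by_cases he : ρ.character = σ.character
  · rw [if_pos he, ← he, sum_character_mul_character_inv hρ]
  · have : Invertible (Nat.card G : ℂ) := invertibleOfNonzero (Nat.cast_ne_zero.2 Nat.card_pos.ne')
    have h := Representation.char_orthonormal ρ σ
    rw [if_neg (fun ⟨e⟩ => he (Representation.char_iso e).symm),
      inv_mul_eq_iff_eq_mul₀ (Nat.cast_ne_zero.2 Nat.card_pos.ne'), mul_zero] at h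
    rw [if_neg he, h]

/-- On an irreducible representation the operator is a scalar of trace zero; a reducible one splits
into two smaller invariant summands. -/
theorem sum_smul_eq_zero_of_orthogonal [Fintype G] (f : G → ℂ)
    (hf : ∀ g x, f (g * x * g⁻¹) = f x) (h : ∀ χ ∈ Irr G, ∑ x, f x * χ x = 0)
    (n : ℕ) : ∀ {V : Type*} [AddCommGroup V] [Module ℂ V] [FiniteDimensional ℂ V]
      (ρ : Representation ℂ G V), finrank ℂ V = n → ∑ x, f x • ρ x = 0 := by
  induction n using Nat.strong_induction_on with
  | _ n ih =>
  intro V _ _ _ ρ hn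
  rcases subsingleton_or_nontrivial V with hV | hV
  · exact LinearMap.ext fun v => Subsingleton.elim _ _
  by_cases hρ : ρ.IsIrreducible
  · obtain ⟨c, hc⟩ := eq_smul_one_of_commute hρ (∑ x, f x • ρ x) (fun g v => by
      simp only [LinearMap.sum_apply, LinearMap.smul_apply, map_sum, map_smul]
      refine Fintype.sum_equiv (MulAut.conj g⁻¹).toEquiv _ _ fun x => ?_
      have h1 : f (g⁻¹ * x * g) = f x := by simpa using hf g⁻¹ x
      simp only [MulEquiv.toEquiv_eq_coe, MulEquiv.coe_toEquiv, MulAut.conj_apply, inv_inv, h1]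
      rw [← Module.End.mul_apply, ← Module.End.mul_apply, ← map_mul, ← map_mul]
      congr 3; group)
    have h2 := congrArg (LinearMap.trace ℂ V) hc
    rw [map_sum, map_smul, ← Module.End.one_eq_id, LinearMap.trace_one, smul_eq_mul] at h2
    have h3 : ∑ x, (LinearMap.trace ℂ V) (f x • ρ x) = 0 := by
      rw [← h _ (character_mem_Irr hρ)]
      exact Finset.sum_congr rfl fun x _ => by rw [map_smul, smul_eq_mul]; rfl
    have hd : (finrank ℂ V : ℂ) ≠ 0 := by exact_mod_cast finrank_pos.ne'
    rw [h3] at h2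
    rw [hc, (mul_eq_zero.1 h2.symm).resolve_right hd, zero_smul]
  · rw [isIrreducible_iff] at hρ
    push Not at hρ
    obtain ⟨W, hW, hW0, hW1⟩ := hρ hV
    obtain ⟨U, hU, hc⟩ := exists_isCompl_stable ρ W hW
    have hU1 : U ≠ ⊤ := fun hU1 => hW0 (by simpa [hU1] using hc.disjoint)
    have key : ∀ (W : Submodule ℂ V) (hW : ∀ g, ∀ w ∈ W, ρ g w ∈ W), W ≠ ⊤ →
        ∀ w ∈ W, (∑ x, f x • ρ x) w = 0 := by
      intro W hW hW1 w hw
      have h1 := ih (finrank ℂ W) (hn ▸ Submodule.finrank_lt hW1) (restrictStable ρ W hW) rfl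
      have h2 := congrArg Subtype.val (LinearMap.congr_fun h1 ⟨w, hw⟩)
      simpa [LinearMap.sum_apply] using h2
    ext v
    have hv : v ∈ W ⊔ U := hc.sup_eq_top ▸ Submodule.mem_top
    obtain ⟨w, hw, y, hy, rfl⟩ := Submodule.mem_sup.1 hv
    rw [map_add, key W hW hW1 w hw, key U hU hU1 y hy]
    simp

/-- In the regular representation the vanishing operator sends the basis vector at 1 to the element
with coefficients `f x`. -/
theorem eq_zero_of_orthogonal [Fintype G] (f : G → ℂ)
    (hf : ∀ g x, f (g * x * g⁻¹) = f x) (h : ∀ χ ∈ Irr G, ∑ x, f x * χ x = 0) (x : G) :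
    f x = 0 := by
  have : FiniteDimensional ℂ (MonoidAlgebra ℂ G) := inferInstance
  have h1 := sum_smul_eq_zero_of_orthogonal f hf h _ (Representation.leftRegular ℂ G) rfl
  have h2 := LinearMap.congr_fun h1 (MonoidAlgebra.single 1 1)
  have h3 := congrArg (fun z => z.coeff x) h2
  classical
  simpa [LinearMap.sum_apply, Finsupp.single_apply] using h3

theorem card_Irr (G : Type*) [Group G] [Finite G] : Nat.card (Irr G) = classNumber G := by
  classical
  have := Fintype.ofFinite G
  let b : Irr G → ConjClasses G → ℂ := fun χ => Quotient.lift χ.1 fun a b h => irr_conj χ.2 h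
  have hb : ∀ χ x, b χ (ConjClasses.mk x) = χ.1 x := fun _ _ => rfl
  have hli : LinearIndependent ℂ b := by
    rw [linearIndependent_iff']
    intro s c hc ψ hψ
    have h1 : ∀ x, ∑ χ ∈ s, c χ * χ.1 x = 0 := fun x => by
      simpa [hb] using congrFun hc (ConjClasses.mk x)
    have h2 : ∑ χ ∈ s, c χ * (if χ.1 = ψ.1 then (Nat.card G : ℂ) else 0) = 0 := by
      calc _ = ∑ χ ∈ s, c χ * ∑ x, χ.1 x * ψ.1 x⁻¹ :=
            Finset.sum_congr rfl fun χ _ => by rw [sum_mul_inv_of_mem_Irr χ.2 ψ.2]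
        _ = ∑ x, (∑ χ ∈ s, c χ * χ.1 x) * ψ.1 x⁻¹ := by
            simp only [Finset.mul_sum, Finset.sum_mul, mul_assoc]
            exact Finset.sum_comm
        _ = 0 := by simp [h1]
    rw [Finset.sum_eq_single ψ (fun χ _ h => by rw [if_neg (fun h' => h (Subtype.ext h')), mul_zero])
      (fun h => absurd hψ h), if_pos rfl] at h2
    exact (mul_eq_zero.1 h2).resolve_right (Nat.cast_ne_zero.2 Nat.card_pos.ne')
  have hsp : ⊤ ≤ Submodule.span ℂ (Set.range b) := by
    by_contra hne
    obtain ⟨φ, hφ, hφ2⟩ := Submodule.exists_le_ker_of_lt_top _ (lt_top_iff_ne_top.2 (fun h => hne h.ge))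
    have hexp : ∀ h : ConjClasses G → ℂ, φ h = ∑ K, φ (Pi.single K 1) * h K := fun h => by
      conv_lhs => rw [← Finset.univ_sum_single h, map_sum]
      refine Finset.sum_congr rfl fun K _ => ?_
      rw [mul_comm, ← smul_eq_mul, ← map_smul, ← Pi.single_smul, smul_eq_mul, mul_one]
    let c : ConjClasses G → ℂ := fun K =>
      ((Finset.univ.filter fun x => ConjClasses.mk x = K).card : ℂ)
    have hc : ∀ K, c K ≠ 0 := fun K => by
      obtain ⟨x, rfl⟩ := ConjClasses.mk_surjective K
      exact Nat.cast_ne_zero.2 (Finset.card_ne_zero.2 ⟨x, by simp⟩)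
    -- Dividing by the class size makes the sum of `f x * χ x` over the group equal to `φ` at `χ`,
    -- which vanishes by the choice of `φ`.
    let f : G → ℂ := fun x => φ (Pi.single (ConjClasses.mk x) 1) / c (ConjClasses.mk x)
    have hf0 := eq_zero_of_orthogonal f (fun g x => by
      have : ConjClasses.mk (g * x * g⁻¹) = ConjClasses.mk x :=
        ConjClasses.mk_eq_mk_iff_isConj.2 (isConj_iff.2 ⟨g⁻¹, by group⟩)
      simp only [f, this]) (fun χ hχ => by
        have h0 : φ (b ⟨χ, hχ⟩) = 0 :=
          LinearMap.mem_ker.1 (hφ2 (Submodule.subset_span ⟨_, rfl⟩))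
        rw [hexp] at h0
        rw [← h0, ← Finset.sum_fiberwise (s := Finset.univ) (g := fun x : G => ConjClasses.mk x)]
        refine Finset.sum_congr rfl fun K _ => ?_
        have h1 : ∀ x ∈ Finset.univ.filter (fun x => ConjClasses.mk x = K), f x * χ x =
            φ (Pi.single K 1) / c K * b ⟨χ, hχ⟩ K := fun x hx => by
          obtain rfl := (Finset.mem_filter.1 hx).2
          rfl
        rw [Finset.sum_congr rfl h1, Finset.sum_const, nsmul_eq_mul]
        change c K * _ = _
        field_simp [hc K])
    refine hφ (LinearMap.ext fun h => ?_)
    rw [hexp, LinearMap.zero_apply]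
    refine Finset.sum_eq_zero fun K _ => ?_
    obtain ⟨x, rfl⟩ := ConjClasses.mk_surjective K
    rw [(div_eq_zero_iff.1 (hf0 x)).resolve_right (hc _), zero_mul]
  have hB := Module.finrank_eq_nat_card_basis (Basis.mk hli hsp)
  rw [← hB, Module.finrank_fintype_fun_eq_card, classNumber, Nat.card_eq_fintype_card]

end Counting

/-! ### Linear constituents of a restriction and their multiplicities. -/

section Weights

variable {P : Type*} [Group P] {V : Type*} [AddCommGroup V] [Module ℂ V]

/-- The common eigenvectors of `P` on `V` with eigenvalues given by `l`. -/
def weightSpace (σ : Representation ℂ P V) (l : P →* ℂ) : Submodule ℂ V where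
  carrier := {v | ∀ x, σ x v = l x • v}
  add_mem' := fun ha hb x => by rw [map_add, ha x, hb x, smul_add]
  zero_mem' := fun x => by simp
  smul_mem' := fun c v hv x => by rw [map_smul, hv x, smul_comm]

theorem exists_weightSpace_ne_bot (σ : Representation ℂ P V) {v : V} (hv : v ≠ 0)
    (h : ∀ x, ∃ c : ℂ, σ x v = c • v) : ∃ l : P →* ℂ, weightSpace σ l ≠ ⊥ := by
  choose c hc using h
  have hinj : ∀ a b : ℂ, a • v = b • v → a = b := fun a b hab => smul_left_injective ℂ hv hab
  refine ⟨⟨⟨c, hinj _ _ ?_⟩, fun x y => hinj _ _ ?_⟩, fun h => hv ?_⟩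
  · rw [← hc, map_one, one_smul]; rfl
  · change c (x * y) • v = (c x * c y) • v
    rw [← hc, map_mul, Module.End.mul_apply, hc y, map_smul, hc x, smul_smul, mul_comm]
  · rw [← Submodule.mem_bot ℂ, ← h]
    exact hc

theorem exists_weightSpace_ne_bot_of_finrank_eq_one (σ : Representation ℂ P V)
    (h : finrank ℂ V = 1) : ∃ l : P →* ℂ, weightSpace σ l ≠ ⊥ := by
  obtain ⟨v, hv, h1⟩ := finrank_eq_one_iff'.1 h
  exact exists_weightSpace_ne_bot σ hv fun x => (h1 (σ x v)).imp fun _ h => h.symm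

theorem weightSpace_ne_bot_of_restrict {σ : Representation ℂ P V} {W : Submodule ℂ V}
    {hW : ∀ g, ∀ w ∈ W, σ g w ∈ W} {l : P →* ℂ} (h : weightSpace (restrictStable σ W hW) l ≠ ⊥) :
    weightSpace σ l ≠ ⊥ := by
  obtain ⟨w, hw, hw0⟩ := Submodule.exists_mem_ne_zero_of_ne_bot h
  intro h'
  refine hw0 (Subtype.ext ((Submodule.mem_bot ℂ).1 (h' ▸ fun x => ?_)))
  exact congrArg Subtype.val (hw x)

/-- Irreducible degrees of a `p`-group are powers of `p`, so in dimension prime to `p` some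
irreducible constituent has degree 1. -/
theorem exists_weightSpace_ne_bot_of_isPGroup [Finite P] {p : ℕ} [Fact p.Prime]
    (hP : IsPGroup p P) (n : ℕ) :
    ∀ {V : Type*} [AddCommGroup V] [Module ℂ V] [FiniteDimensional ℂ V]
      (σ : Representation ℂ P V), finrank ℂ V = n → ¬ p ∣ n →
      ∃ l : P →* ℂ, weightSpace σ l ≠ ⊥ := by
  induction n using Nat.strong_induction_on with
  | _ n ih =>
  intro V _ _ _ σ hn hp
  have hV : Nontrivial V := by
    apply nontrivial_of_finrank_pos (R := ℂ)
    rw [hn]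
    exact Nat.pos_of_ne_zero fun h => hp (h ▸ dvd_zero p)
  by_cases hσ : σ.IsIrreducible
  · obtain ⟨k, hk⟩ := hP.exists_card_eq
    have h1 := finrank_dvd_card hσ
    rw [hk, Nat.dvd_prime_pow Fact.out] at h1
    obtain ⟨j, -, hj⟩ := h1
    rcases Nat.eq_zero_or_pos j with rfl | h0
    · exact exists_weightSpace_ne_bot_of_finrank_eq_one σ (by simpa using hj)
    · exact absurd (hn ▸ hj ▸ dvd_pow_self p h0.ne') hp
  · rw [isIrreducible_iff] at hσ
    push Not at hσ
    obtain ⟨W, hW, hW0, hW1⟩ := hσ hV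
    obtain ⟨U, hU, hc⟩ := exists_isCompl_stable σ W hW
    have hU1 : U ≠ ⊤ := fun hU1 => hW0 (by simpa [hU1] using hc.disjoint)
    have hsum := Submodule.finrank_add_eq_of_isCompl hc
    by_cases hpW : p ∣ finrank ℂ W
    · have hpU : ¬ p ∣ finrank ℂ U := fun h => hp (hn ▸ hsum ▸ dvd_add hpW h)
      obtain ⟨l, hl⟩ := ih _ (hn ▸ Submodule.finrank_lt hU1) (restrictStable σ U hU) rfl hpU
      exact ⟨l, weightSpace_ne_bot_of_restrict hl⟩
    · obtain ⟨l, hl⟩ := ih _ (hn ▸ Submodule.finrank_lt hW1) (restrictStable σ W hW) rfl hpW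
      exact ⟨l, weightSpace_ne_bot_of_restrict hl⟩

theorem exists_weightSpace_ne_bot_of_comm [IsMulCommutative P] (n : ℕ) :
    ∀ {V : Type*} [AddCommGroup V] [Module ℂ V] [FiniteDimensional ℂ V]
      (σ : Representation ℂ P V), finrank ℂ V = n → Nontrivial V →
      ∃ l : P →* ℂ, weightSpace σ l ≠ ⊥ := by
  induction n using Nat.strong_induction_on with
  | _ n ih =>
  intro V _ _ _ σ hn hV
  by_cases hσ : σ.IsIrreducible
  · exact exists_weightSpace_ne_bot_of_finrank_eq_one σ
      (Representation.IsIrreducible.finrank_eq_one_of_isMulCommutative σ)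
  · rw [isIrreducible_iff] at hσ
    push Not at hσ
    obtain ⟨W, hW, hW0, hW1⟩ := hσ hV
    obtain ⟨l, hl⟩ := ih _ (hn ▸ Submodule.finrank_lt hW1) (restrictStable σ W hW) rfl
      (Submodule.nontrivial_iff_ne_bot.2 hW0)
    exact ⟨l, weightSpace_ne_bot_of_restrict hl⟩

/-- The projection onto a weight space. -/
def weightProj [Fintype P] (σ : Representation ℂ P V) (l : P →* ℂ) : V →ₗ[ℂ] V :=
  (Nat.card P : ℂ)⁻¹ • ∑ x, l x⁻¹ • σ x

theorem weightProj_apply [Fintype P] (σ : Representation ℂ P V) (l : P →* ℂ) (v : V) :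
    weightProj σ l v = (Nat.card P : ℂ)⁻¹ • ∑ x, l x⁻¹ • σ x v := by
  simp [weightProj, LinearMap.sum_apply]

theorem apply_inv_mul_apply (l : P →* ℂ) (x : P) : l x⁻¹ * l x = 1 := by
  rw [← map_mul, inv_mul_cancel, map_one]

theorem isProj_weightProj [Fintype P] (σ : Representation ℂ P V) (l : P →* ℂ) :
    LinearMap.IsProj (weightSpace σ l) (weightProj σ l) := by
  refine ⟨fun v y => ?_, fun v hv => ?_⟩
  · rw [weightProj_apply, map_smul, smul_comm (l y), map_sum]
    congr 1
    rw [Finset.smul_sum]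
    refine Fintype.sum_equiv (Equiv.mulLeft y) _ _ fun x => ?_
    rw [Equiv.coe_mulLeft, map_smul, ← Module.End.mul_apply, ← map_mul, smul_smul]
    congr 1
    rw [mul_inv_rev, map_mul, mul_left_comm, mul_comm (l y), apply_inv_mul_apply, mul_one]
  · have h1 : ∀ x ∈ Finset.univ, l x⁻¹ • σ x v = v := fun x _ => by
      rw [hv x, smul_smul, apply_inv_mul_apply, one_smul]
    rw [weightProj_apply, Finset.sum_congr rfl h1, Finset.sum_const, Finset.card_univ,
      ← Nat.card_eq_fintype_card, ← Nat.cast_smul_eq_nsmul ℂ, smul_smul,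
      inv_mul_cancel₀ (Nat.cast_ne_zero.2 Nat.card_pos.ne'), one_smul]

theorem weightProj_apply_of_ne [Fintype P] (σ : Representation ℂ P V) {l m : P →* ℂ} (hlm : l ≠ m)
    {v : V} (hv : v ∈ weightSpace σ m) : weightProj σ l v = 0 := by
  have h1 := (isProj_weightProj σ l).map_mem v
  have h2 : weightProj σ l v ∈ weightSpace σ m := by
    rw [weightProj_apply]
    refine Submodule.smul_mem _ _ (Submodule.sum_mem _ fun x _ => Submodule.smul_mem _ _ ?_)
    rw [hv x]
    exact Submodule.smul_mem _ _ hv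
  by_contra h0
  exact hlm (MonoidHom.ext fun x => smul_left_injective ℂ h0 ((h1 x).symm.trans (h2 x)))

theorem finrank_weightSpace [Fintype P] [FiniteDimensional ℂ V] (σ : Representation ℂ P V)
    (l : P →* ℂ) : (finrank ℂ (weightSpace σ l) : ℂ) =
      (Nat.card P : ℂ)⁻¹ * ∑ x, l x⁻¹ * σ.character x := by
  rw [← (isProj_weightProj σ l).trace, weightProj, map_smul, map_sum, smul_eq_mul]
  congr 1
  exact Finset.sum_congr rfl fun x _ => by rw [map_smul, smul_eq_mul]; rfl

/-- If the character of `σ` is fixed by a field automorphism raising the roots of unity of order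
dividing `|P|` to the `k`-th power, then `l` and `l ^ k` have the same multiplicity. -/
theorem finrank_weightSpace_pow [Finite P] [FiniteDimensional ℂ V] (σ : Representation ℂ P V)
    (l : P →* ℂ) {F : IntermediateField ℚ ℂ} (τ : F →+* ℂ) (k : ℕ)
    (hχ : ∀ x, ∃ z : F, (z : ℂ) = σ.character x ∧ τ z = σ.character x)
    (hτ : ∀ ζ : ℂ, ζ ^ Nat.card P = 1 → ∃ z : F, (z : ℂ) = ζ ∧ τ z = ζ ^ k) :
    finrank ℂ (weightSpace σ (l ^ k)) = finrank ℂ (weightSpace σ l) := by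
  have := Fintype.ofFinite P
  choose z hz1 hz2 using hχ
  have hl : ∀ x, ∃ z : F, (z : ℂ) = l x ∧ τ z = l x ^ k := fun x =>
    hτ _ (by rw [← map_pow, pow_card_eq_one', map_one])
  choose y hy1 hy2 using hl
  have h0 : (Nat.card P : ℂ) ≠ 0 := Nat.cast_ne_zero.2 Nat.card_pos.ne'
  have h1 := finrank_weightSpace σ l
  have h2 := finrank_weightSpace σ (l ^ k)
  rw [eq_inv_mul_iff_mul_eq₀ h0] at h1 h2
  -- The multiplicity formula is lifted to `F` so that `τ` can be applied: the integer on the left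
  -- is fixed, while `l` becomes `l ^ k` on the right.
  have h3 : (Nat.card P * finrank ℂ (weightSpace σ l) : F) = ∑ x, y x⁻¹ * z x := by
    apply Subtype.ext
    push_cast
    simp only [hz1, hy1]
    exact h1
  have h4 := congrArg τ h3
  rw [map_mul, map_natCast, map_natCast, map_sum] at h4
  have h5 : ∑ x, τ (y x⁻¹ * z x) = ∑ x, (l ^ k) x⁻¹ * σ.character x :=
    Finset.sum_congr rfl fun x _ => by rw [map_mul, hy2, hz2, MonoidHom.pow_apply]
  rw [h5, ← h2] at h4
  exact_mod_cast (mul_left_cancel₀ h0 h4).symm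

end Weights

/-! ### Clifford theory over a normal subgroup, for linear constituents. -/

section Clifford

variable {N : Type*} [Group N] {V : Type*} [AddCommGroup V] [Module ℂ V]

/-- The conjugation action on linear characters of a normal subgroup. -/
abbrev conjWeightAction (P : Subgroup N) [P.Normal] : MulAction N (P →* ℂ) where
  smul g l := l.comp (MulAut.conjNormal g⁻¹).toMonoidHom
  one_smul l := by
    change l.comp (MulAut.conjNormal (1 : N)⁻¹).toMonoidHom = l
    ext x; simp
  mul_smul g h l := by
    change l.comp (MulAut.conjNormal (g * h)⁻¹).toMonoidHom =
      (l.comp (MulAut.conjNormal h⁻¹).toMonoidHom).comp (MulAut.conjNormal g⁻¹).toMonoidHom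
    ext x; simp

attribute [local instance] conjWeightAction

variable {P : Subgroup N} [P.Normal]

theorem conjWeight_apply (g : N) (l : P →* ℂ) (x : P) :
    (g • l) x = l (MulAut.conjNormal g⁻¹ x) := rfl

theorem le_stabilizer_weight (l : P →* ℂ) : P ≤ MulAction.stabilizer N l := by
  intro y hy
  rw [MulAction.mem_stabilizer_iff]
  ext x
  have : MulAut.conjNormal y⁻¹ x = (⟨y, hy⟩ : P)⁻¹ * x * ⟨y, hy⟩ := by
    ext; simp
  rw [conjWeight_apply, this, map_mul, map_mul, mul_right_comm, apply_inv_mul_apply, one_mul]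

theorem apply_mem_weightSpace (ρ : Representation ℂ N V) (g : N) {l : P →* ℂ} {v : V}
    (hv : v ∈ weightSpace (ρ.comp P.subtype) l) :
    ρ g v ∈ weightSpace (ρ.comp P.subtype) (g • l) := by
  intro x
  have h := hv (MulAut.conjNormal g⁻¹ x)
  rw [conjWeight_apply, ← map_smul, ← h]
  simp only [MonoidHom.comp_apply, Subgroup.coe_subtype, ← Module.End.mul_apply, ← map_mul]
  congr 2
  simp [mul_assoc]

/-- The translates of `E` span a nonzero invariant subspace. This reduces identities of operators on
`V` to checks on the translates of one weight space. -/
theorem eq_top_of_apply_mem {ρ : Representation ℂ N V} (hρ : ρ.IsIrreducible)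
    {E : Submodule ℂ V} (hE : E ≠ ⊥) (U : Submodule ℂ V) (h : ∀ g, ∀ w ∈ E, ρ g w ∈ U) :
    U = ⊤ := by
  let S : Submodule ℂ V := ⨆ g, E.map (ρ g)
  have hS : ∀ g, ∀ w ∈ S, ρ g w ∈ S := by
    intro g
    change S ≤ S.comap (ρ g)
    refine iSup_le fun h => ?_
    rw [Submodule.map_le_iff_le_comap]
    intro w hw
    refine (le_iSup (fun g => E.map (ρ g)) (g * h)) ⟨w, hw, ?_⟩
    rw [map_mul]; rfl
  have hSU : S ≤ U := iSup_le fun g => by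
    rw [Submodule.map_le_iff_le_comap]
    exact h g
  rcases ((isIrreducible_iff ρ).1 hρ).2 S hS with h0 | h1
  · exfalso
    refine hE (eq_bot_iff.2 fun w hw => ?_)
    rw [← h0]
    exact (le_iSup (fun g => E.map (ρ g)) 1) ⟨w, hw, by simp⟩
  · exact top_le_iff.1 (h1 ▸ hSU)

theorem mem_orbit_of_weightSpace_ne_bot [Finite N] {ρ : Representation ℂ N V}
    (hρ : ρ.IsIrreducible) {l m : P →* ℂ} (hl : weightSpace (ρ.comp P.subtype) l ≠ ⊥)
    (hm : weightSpace (ρ.comp P.subtype) m ≠ ⊥) : m ∈ MulAction.orbit N l := by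
  have := Fintype.ofFinite P
  by_contra hml
  have h1 := eq_top_of_apply_mem hρ hl (LinearMap.ker (weightProj (ρ.comp P.subtype) m))
    fun g w hw => LinearMap.mem_ker.2 (weightProj_apply_of_ne _ (fun h => hml ⟨g, h.symm⟩)
      (apply_mem_weightSpace ρ g hw))
  obtain ⟨v, hv, hv0⟩ := Submodule.exists_mem_ne_zero_of_ne_bot hm
  have h2 : v ∈ LinearMap.ker (weightProj (ρ.comp P.subtype) m) := h1 ▸ Submodule.mem_top
  rw [LinearMap.mem_ker, (isProj_weightProj (ρ.comp P.subtype) m).map_id v hv] at h2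
  exact hv0 h2

theorem finrank_weightSpace_smul [FiniteDimensional ℂ V] (ρ : Representation ℂ N V) (g : N)
    (l : P →* ℂ) : finrank ℂ (weightSpace (ρ.comp P.subtype) (g • l)) =
      finrank ℂ (weightSpace (ρ.comp P.subtype) l) := by
  have key : ∀ (g : N) (l : P →* ℂ), finrank ℂ (weightSpace (ρ.comp P.subtype) l) ≤
      finrank ℂ (weightSpace (ρ.comp P.subtype) (g • l)) := fun g l => by
    have hinj : Function.Injective (ρ g) := fun a b hab => by
      have := congrArg (ρ g⁻¹) hab
      simpa [← Module.End.mul_apply, ← map_mul] using this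
    rw [(Submodule.equivMapOfInjective (ρ g) hinj _).finrank_eq]
    refine Submodule.finrank_mono ?_
    rw [Submodule.map_le_iff_le_comap]
    exact fun v hv => apply_mem_weightSpace ρ g hv
  refine le_antisymm ?_ (key g l)
  have := key g⁻¹ (g • l)
  rwa [inv_smul_smul] at this

/-- The projections onto the weight spaces in the orbit add up to the identity; the traces of the
summands are all equal. -/
theorem finrank_eq_card_orbit_mul [Finite N] [FiniteDimensional ℂ V] {ρ : Representation ℂ N V}
    (hρ : ρ.IsIrreducible) {l : P →* ℂ} (hl : weightSpace (ρ.comp P.subtype) l ≠ ⊥) :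
    finrank ℂ V = Nat.card (MulAction.orbit N l) *
      finrank ℂ (weightSpace (ρ.comp P.subtype) l) := by
  classical
  have := Fintype.ofFinite P
  have : Finite (MulAction.orbit N l) := Set.finite_range _
  have := Fintype.ofFinite (MulAction.orbit N l)
  have h1 : ∑ m : MulAction.orbit N l, weightProj (ρ.comp P.subtype) m.1 = LinearMap.id := by
    rw [← sub_eq_zero, ← LinearMap.ker_eq_top]
    refine eq_top_of_apply_mem hρ hl _ fun g w hw => ?_
    rw [LinearMap.mem_ker, LinearMap.sub_apply, sub_eq_zero, LinearMap.sum_apply,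
      LinearMap.id_apply]
    have hw' := apply_mem_weightSpace ρ g hw
    rw [Finset.sum_eq_single ⟨g • l, g, rfl⟩
      (fun m _ hm => weightProj_apply_of_ne _ (fun h => hm (Subtype.ext h)) hw')
      (fun h => absurd (Finset.mem_univ _) h)]
    exact (isProj_weightProj (ρ.comp P.subtype) _).map_id _ hw'
  have h2 := congrArg (LinearMap.trace ℂ V) h1
  rw [map_sum, ← Module.End.one_eq_id, LinearMap.trace_one] at h2
  have h3 : ∀ m : MulAction.orbit N l, LinearMap.trace ℂ V (weightProj (ρ.comp P.subtype) m.1) =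
      finrank ℂ (weightSpace (ρ.comp P.subtype) l) := by
    rintro ⟨_, g, rfl⟩
    rw [(isProj_weightProj (ρ.comp P.subtype) _).trace]
    exact_mod_cast finrank_weightSpace_smul ρ g l
  rw [Finset.sum_congr rfl fun m _ => h3 m, Finset.sum_const, Finset.card_univ,
    ← Nat.card_eq_fintype_card, nsmul_eq_mul] at h2
  exact_mod_cast h2.symm

theorem card_orbit_weight_dvd_index [Finite N] (l : P →* ℂ) :
    Nat.card (MulAction.orbit N l) ∣ P.index := by
  rw [Nat.card_coe_set_eq, ← MulAction.index_stabilizer]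
  exact Subgroup.index_dvd_of_le (le_stabilizer_weight l)

/-- The weight space is irreducible under `S`. Translates of an `S`-stable subspace `W` by the
stabilizer `SP` stay in `W`, since `P` acts by scalars, and all other translates are killed by the
projection; since the translates span `V`, a nonzero `W` is everything. -/
theorem finrank_weightSpace_dvd_card [Finite N] [FiniteDimensional ℂ V]
    {ρ : Representation ℂ N V} (hρ : ρ.IsIrreducible) {l : P →* ℂ}
    (hl : weightSpace (ρ.comp P.subtype) l ≠ ⊥) {S : Subgroup N}
    (hS : S ≤ MulAction.stabilizer N l)
    (hSP : ∀ g ∈ MulAction.stabilizer N l, ∃ s ∈ S, ∃ x ∈ P, g = s * x) :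
    finrank ℂ (weightSpace (ρ.comp P.subtype) l) ∣ Nat.card S := by
  have := Fintype.ofFinite P
  have hst : ∀ g : S, ∀ w ∈ weightSpace (ρ.comp P.subtype) l,
      (ρ.comp S.subtype) g w ∈ weightSpace (ρ.comp P.subtype) l := fun g w hw => by
    have := apply_mem_weightSpace ρ g.1 hw
    rwa [MulAction.mem_stabilizer_iff.1 (hS g.2)] at this
  apply finrank_dvd_card (ρ := restrictStable (ρ.comp S.subtype) _ hst)
  refine (isIrreducible_iff _).2 ⟨Submodule.nontrivial_iff_ne_bot.2 hl, fun W hW => ?_⟩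
  refine or_iff_not_imp_left.2 fun hW0 => ?_
  let W' := W.map (Submodule.subtype _)
  have hW' : W' ≠ ⊥ := fun h => hW0 (eq_bot_iff.2 fun w hw => by
    have h1 : w.1 ∈ W' := ⟨w, hw, rfl⟩
    rw [h, Submodule.mem_bot] at h1
    exact (Submodule.mem_bot ℂ).2 (Subtype.ext h1))
  have h1 := eq_top_of_apply_mem hρ hW' (W'.comap (weightProj (ρ.comp P.subtype) l)) (by
    rintro g _ ⟨w, hw, rfl⟩
    rw [Submodule.mem_comap]
    by_cases hg : g ∈ MulAction.stabilizer N l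
    · obtain ⟨s, hs, x, hx, rfl⟩ := hSP g hg
      have h3 : ρ (s * x) (Submodule.subtype _ w) =
          l ⟨x, hx⟩ • Submodule.subtype _ (restrictStable (ρ.comp S.subtype) _ hst ⟨s, hs⟩ w) := by
        rw [map_mul, Module.End.mul_apply]
        have := w.2 ⟨x, hx⟩
        simp only [MonoidHom.comp_apply, Subgroup.coe_subtype] at this
        rw [Submodule.subtype_apply, this, map_smul]
        rfl
      rw [h3, map_smul, Submodule.subtype_apply,
        (isProj_weightProj (ρ.comp P.subtype) l).map_id _ (Subtype.property _)]
      exact Submodule.smul_mem _ _ ⟨_, hW ⟨s, hs⟩ w hw, rfl⟩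
    · rw [Submodule.subtype_apply, weightProj_apply_of_ne _ (fun h => hg h.symm) (apply_mem_weightSpace ρ g w.2)]
      exact Submodule.zero_mem _)
  rw [eq_top_iff]
  intro w _
  have h2 : w.1 ∈ W'.comap (weightProj (ρ.comp P.subtype) l) := h1 ▸ Submodule.mem_top
  rw [Submodule.mem_comap, (isProj_weightProj (ρ.comp P.subtype) l).map_id _ w.2] at h2
  obtain ⟨w', hw', h⟩ := h2
  rwa [← Subtype.ext h]

/-- The degree is the orbit length of a weight times its multiplicity. The first divides the index
of `P`; the second divides the order of a subgroup of a complement of `P`. -/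
theorem not_dvd_finrank_of_comm [Finite N] [FiniteDimensional ℂ V] {ρ : Representation ℂ N V}
    (hρ : ρ.IsIrreducible) {p : ℕ} [Fact p.Prime] (hP : IsPGroup p P) [IsMulCommutative P]
    (hi : ¬ p ∣ P.index) : ¬ p ∣ finrank ℂ V := by
  obtain ⟨hV, -⟩ := (isIrreducible_iff ρ).1 hρ
  obtain ⟨l, hl⟩ := exists_weightSpace_ne_bot_of_comm _ (ρ.comp P.subtype) rfl hV
  have hcop : (Nat.card P).Coprime P.index := by
    obtain ⟨k, hk⟩ := hP.exists_card_eq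
    rw [hk]
    exact Nat.Coprime.pow_left k ((Nat.Prime.coprime_iff_not_dvd Fact.out).2 hi)
  obtain ⟨H, hH⟩ := Subgroup.exists_left_complement'_of_coprime hcop
  have hHi : Nat.card H = P.index := hH.symm.card_right.symm ▸ rfl
  have h1 := finrank_weightSpace_dvd_card hρ hl (S := H ⊓ MulAction.stabilizer N l) inf_le_right
    (fun g hg => by
      obtain ⟨⟨s, x⟩, rfl⟩ := hH.2 g
      exact ⟨s, ⟨s.2, ((Subgroup.mul_mem_cancel_right _ (le_stabilizer_weight l x.2)).1 hg)⟩,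
        x, x.2, rfl⟩)
  have h2 := h1.trans (Subgroup.card_dvd_of_le inf_le_left)
  rw [hHi] at h2
  rw [finrank_eq_card_orbit_mul hρ hl]
  intro hd
  rcases (Nat.Prime.dvd_mul Fact.out).1 hd with h | h
  · exact hi (h.trans (card_orbit_weight_dvd_index l))
  · exact hi (h.trans h2)

/-- If the weight multiplicities are invariant under `l ↦ l ^ k` with `k ≡ 1 + p`, and there
are a number of weights prime to `p`, then some weight has order dividing `p`. -/
theorem exists_weight_pow_eq_one [Finite N] [FiniteDimensional ℂ V] {ρ : Representation ℂ N V}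
    (hρ : ρ.IsIrreducible) {p : ℕ} [hp : Fact p.Prime] {b : ℕ} (hP : Nat.card P = p ^ (b + 1))
    (hi : ¬ p ∣ P.index) (hd : ¬ p ∣ finrank ℂ V) {k : ℕ} (hk : k ≡ 1 + p [MOD p ^ (b + 1)])
    (hkl : ∀ l : P →* ℂ, finrank ℂ (weightSpace (ρ.comp P.subtype) (l ^ k)) =
      finrank ℂ (weightSpace (ρ.comp P.subtype) l)) :
    ∃ l : P →* ℂ, weightSpace (ρ.comp P.subtype) l ≠ ⊥ ∧ ∀ x, l x ^ p = 1 := by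
  classical
  obtain ⟨l, hl⟩ := exists_weightSpace_ne_bot_of_isPGroup (IsPGroup.of_card hP) _
    (ρ.comp P.subtype) rfl hd
  have : Finite (MulAction.orbit N l) := Set.finite_range _
  have := Fintype.ofFinite (MulAction.orbit N l)
  have hne : ∀ m : P →* ℂ, weightSpace (ρ.comp P.subtype) m ≠ ⊥ ↔
      finrank ℂ (weightSpace (ρ.comp P.subtype) m) ≠ 0 := fun m => by
    rw [Ne, Ne, Submodule.finrank_eq_zero]
  have horb : ∀ m ∈ MulAction.orbit N l, weightSpace (ρ.comp P.subtype) m ≠ ⊥ := by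
    rintro _ ⟨g, rfl⟩
    rw [hne]
    exact (finrank_weightSpace_smul ρ g l).trans_ne ((hne l).1 hl)
  -- Raising to the `k`-th power preserves multiplicities, hence the set of weights that occur, and
  -- that set is the single orbit of `l`.
  let f : Function.End (MulAction.orbit N l) := fun m => ⟨m.1 ^ k,
    mem_orbit_of_weightSpace_ne_bot hρ hl (by rw [hne, hkl, ← hne]; exact horb _ m.2)⟩
  have hf : ∀ (j : ℕ) m, ((f ^ j) m).1 = m.1 ^ k ^ j := by
    intro j
    induction j with
    | zero => intro m; rw [pow_zero, pow_zero, pow_one]; rfl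
    | succ j ih =>
      intro m
      rw [pow_succ, pow_succ', pow_mul]
      exact ih (f m)
  have hone : ∀ (m : P →* ℂ) x, m x ^ p ^ (b + 1) = 1 := fun m x => by
    rw [← map_pow, ← hP, pow_card_eq_one', map_one]
  have hmod : ∀ (m : P →* ℂ) {i j : ℕ}, i ≡ j [MOD p ^ (b + 1)] → m ^ i = m ^ j :=
    fun m i j hij => by
      ext x
      rw [MonoidHom.pow_apply, MonoidHom.pow_apply]
      exact pow_eq_pow_of_modEq hij (hone m x)
  -- From k ≡ 1 mod p follows k^(p^b) ≡ 1 mod p^(b+1). So `f` has `p`-power order on a set of size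
  -- prime to `p`, and must fix a point.
  have hf1 : f ^ p ^ b = 1 := by
    funext m
    refine Subtype.ext ?_
    rw [hf]
    refine (hmod m.1 (j := 1) ?_).trans (pow_one _)
    have hk1 : (p : ℤ) ∣ (k : ℤ) - 1 := by
      have h1 : k ≡ 1 + p [MOD p] := hk.of_dvd (dvd_pow_self p b.succ_ne_zero)
      have h2 := (Nat.modEq_iff_dvd.1 h1.symm)
      push_cast at h2
      have h3 := dvd_add h2 (dvd_refl (p : ℤ))
      rwa [show (k : ℤ) - (1 + p) + p = k - 1 by ring] at h3
    have h4 := dvd_sub_pow_of_dvd_sub hk1 b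
    refine (Nat.modEq_iff_dvd.2 ?_).symm
    push_cast
    simpa using h4
  have hcard := Equiv.Perm.card_fixedPoints_modEq hf1
  have hfix : Fintype.card f.fixedPoints ≠ 0 := by
    intro h0
    rw [h0] at hcard
    have h1 := (Nat.modEq_zero_iff_dvd.1 hcard)
    rw [← Nat.card_eq_fintype_card] at h1
    exact hi (h1.trans (card_orbit_weight_dvd_index l))
  obtain ⟨m, hm⟩ := Fintype.card_pos_iff.1 (Nat.pos_of_ne_zero hfix)
  refine ⟨m.1, horb _ m.2, fun x => ?_⟩
  -- A fixed weight satisfies m^(1+p) = m, and its values are invertible.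
  have h1 : m.1 ^ k = m.1 := congrArg Subtype.val hm
  have h2 := DFunLike.congr_fun ((hmod m.1 hk).symm.trans h1) x
  rw [MonoidHom.pow_apply, pow_add, pow_one] at h2
  refine mul_left_cancel₀ (a := m.1 x) (fun h0 => ?_) (h2.trans (mul_one _).symm)
  have h3 := apply_inv_mul_apply m.1 x
  rw [h0, mul_zero] at h3
  exact zero_ne_one h3

end Clifford

/-! ### Cyclotomic fields and the Galois description of almost rationality. -/

section Cyclotomic

theorem pow_eq_one_of_exponent_dvd {M : Type*} [Monoid M] {x : M} {a b : ℕ} (h : x ^ a = 1)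
    (hab : a ∣ b) : x ^ b = 1 :=
  orderOf_dvd_iff_pow_eq_one.1 ((orderOf_dvd_of_pow_eq_one h).trans hab)

/-- The generator `e^{2πi/n}` of `ℚ_n`. -/
def cycGen (n : ℕ) : cycField n :=
  ⟨Complex.exp (2 * Real.pi * Complex.I / n), IntermediateField.mem_adjoin_simple_self _ _⟩

theorem isPrimitiveRoot_cycGen (n : ℕ) [NeZero n] : IsPrimitiveRoot (cycGen n) n :=
  IsPrimitiveRoot.of_map_of_injective (f := (cycField n).val)
    (Complex.isPrimitiveRoot_exp n (NeZero.ne n)) (cycField n).val.injective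

instance isCyclotomicExtension_cycField (n : ℕ) [NeZero n] :
    IsCyclotomicExtension {n} ℚ (cycField n) := by
  have h := Complex.isPrimitiveRoot_exp n (NeZero.ne n)
  have hi : IsIntegral ℚ (Complex.exp (2 * Real.pi * Complex.I / n)) :=
    IsIntegral.of_pow (NeZero.pos n) (by rw [h.pow_eq_one]; exact isIntegral_one)
  change IsCyclotomicExtension {n} ℚ (cycField n).toSubalgebra
  rw [IntermediateField.adjoin_simple_toSubalgebra_of_isAlgebraic hi.isAlgebraic]
  exact h.adjoin_isCyclotomicExtension ℚ

instance numberField_cycField (n : ℕ) [NeZero n] : NumberField (cycField n) :=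
  IsCyclotomicExtension.numberField {n} ℚ (cycField n)

theorem mem_cycField_of_pow_eq_one {n : ℕ} [NeZero n] {ζ : ℂ} (h : ζ ^ n = 1) :
    ζ ∈ cycField n := by
  obtain ⟨i, -, rfl⟩ := (Complex.isPrimitiveRoot_exp n (NeZero.ne n)).eq_pow_of_pow_eq_one h
  exact pow_mem (cycGen n).2 i

theorem cycField_le {m n : ℕ} (hm : m ≠ 0) [NeZero n] (h : m ∣ n) : cycField m ≤ cycField n := by
  rw [IntermediateField.adjoin_simple_le_iff]
  apply mem_cycField_of_pow_eq_one
  obtain ⟨c, rfl⟩ := h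
  rw [pow_mul, (Complex.isPrimitiveRoot_exp m hm).pow_eq_one, one_pow]

theorem character_mem_cycField {G : Type*} [Group G] [Finite G] {χ : G → ℂ} (hχ : χ ∈ Irr G)
    {L : ℕ} [NeZero L] {g : G} (hg : g ^ L = 1) : χ g ∈ cycField L := by
  obtain ⟨n, ρ, -, rfl⟩ := hχ
  obtain ⟨s, -, hs, h⟩ := exists_roots_of_unity_sum ρ g
  rw [h]
  exact multiset_sum_mem _ fun μ hμ => mem_cycField_of_pow_eq_one
    (pow_eq_one_of_exponent_dvd (hs μ hμ) (orderOf_dvd_of_pow_eq_one hg))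

theorem cycField_ringHom_ext {n : ℕ} [NeZero n] {f g : cycField n →ₐ[ℚ] ℂ}
    (h : f (cycGen n) = g (cycGen n)) : f = g :=
  ((isPrimitiveRoot_cycGen n).powerBasis ℚ).algHom_ext (by
    rwa [IsPrimitiveRoot.powerBasis_gen])

theorem exists_galois_pow {n k : ℕ} [NeZero n] (h : k.Coprime n) :
    ∃ σ : cycField n ≃ₐ[ℚ] cycField n, ∀ ξ, ξ ^ n = 1 → σ ξ = ξ ^ k := by
  refine ⟨(IsCyclotomicExtension.Rat.galEquivZMod n (cycField n)).symm (ZMod.unitOfCoprime k h),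
    fun ξ hξ => ?_⟩
  rw [IsCyclotomicExtension.Rat.galEquivZMod_apply_of_pow_eq n (cycField n) _ hξ,
    MulEquiv.apply_symm_apply, ZMod.coe_unitOfCoprime]
  refine pow_eq_pow_of_modEq ?_ hξ
  rw [ZMod.val_natCast]
  exact Nat.mod_modEq k n

theorem exists_pow_of_galois {n : ℕ} [NeZero n] (σ : cycField n ≃ₐ[ℚ] cycField n) :
    ∃ k : ℕ, k.Coprime n ∧ ∀ ξ, ξ ^ n = 1 → σ ξ = ξ ^ k :=
  ⟨_, ZMod.val_coe_unit_coprime (IsCyclotomicExtension.Rat.galEquivZMod n (cycField n) σ),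
    fun _ hξ => IsCyclotomicExtension.Rat.galEquivZMod_apply_of_pow_eq n (cycField n) σ hξ⟩

theorem exists_dvd_prime_mul {p n : ℕ} (hn : 0 < n) (h : ¬ p ^ 2 ∣ n) :
    ∃ n' : ℕ, n' ≠ 0 ∧ ¬ p ∣ n' ∧ n ∣ p * n' := by
  by_cases hp : p ∣ n
  · obtain ⟨n', rfl⟩ := hp
    refine ⟨n', by rintro rfl; simp at hn, fun h' => h ?_, dvd_rfl⟩
    rw [pow_two]
    exact mul_dvd_mul_left p h'
  · exact ⟨n, hn.ne', hp, dvd_mul_left n p⟩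

/-- An automorphism raising roots of unity to the `k`-th power fixes `ℚ_n` if `k ≡ 1` mod `n`. -/
theorem galois_apply_eq_self {M n k : ℕ} [NeZero M] (hn : n ≠ 0) (hnM : n ∣ M)
    {τ : cycField M ≃ₐ[ℚ] cycField M} (hτ : ∀ ξ, ξ ^ M = 1 → τ ξ = ξ ^ k)
    (hk : k ≡ 1 [MOD n]) {z : cycField M} (hz : (z : ℂ) ∈ cycField n) : τ z = z := by
  have : NeZero n := ⟨hn⟩
  let i : cycField n →ₐ[ℚ] cycField M := IntermediateField.inclusion (cycField_le hn hnM)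
  have h := cycField_ringHom_ext (f := ((cycField M).val.comp (τ : cycField M →ₐ[ℚ] cycField M)).comp i)
    (g := (cycField M).val.comp i) (by
      have h1 : (i (cycGen n)) ^ n = 1 := by
        rw [← map_pow, (isPrimitiveRoot_cycGen n).pow_eq_one, map_one]
      have h2 : (i (cycGen n)) ^ M = 1 := pow_eq_one_of_exponent_dvd h1 hnM
      change ((τ (i (cycGen n)) : cycField M) : ℂ) = (i (cycGen n) : ℂ)
      rw [hτ _ h2, pow_eq_pow_of_modEq hk h1, pow_one])
  have h3 := DFunLike.congr_fun h ⟨z, hz⟩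
  exact Subtype.ext h3

/-- An almost `p`-rational function is fixed by a field homomorphism raising the `p`-power roots
of unity to the power `1 + p`. -/
theorem exists_ringHom_of_isAlmostRational {X : Type*} {χ : X → ℂ} {p : ℕ} (hp : p.Prime)
    (hχ : IsAlmostRational p χ) (b : ℕ) :
    ∃ k : ℕ, k ≡ 1 + p [MOD p ^ (b + 1)] ∧ ∃ (F : IntermediateField ℚ ℂ) (τ : F →+* ℂ),
      (∀ x, ∃ z : F, (z : ℂ) = χ x ∧ τ z = χ x) ∧
      ∀ ζ : ℂ, ζ ^ p ^ (b + 1) = 1 → ∃ z : F, (z : ℂ) = ζ ∧ τ z = ζ ^ k := by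
  obtain ⟨n, hn, hpn, hval⟩ := hχ
  obtain ⟨n', hn0, hpn', hnn'⟩ := exists_dvd_prime_mul hn hpn
  have hcop : (p ^ (b + 1)).Coprime n' :=
    Nat.Coprime.pow_left _ ((Nat.Prime.coprime_iff_not_dvd hp).2 hpn')
  -- The exponent is 1 modulo `p * n'`, so the values of `χ` are fixed, yet it moves roots of unity
  -- of order p² when these are present.
  obtain ⟨k, hk1, hk2⟩ := Nat.chineseRemainder hcop (1 + p) 1
  have hM : NeZero (p ^ (b + 1) * n') := ⟨mul_ne_zero (pow_ne_zero _ hp.ne_zero) hn0⟩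
  have hkM : k.Coprime (p ^ (b + 1) * n') := by
    refine Nat.Coprime.mul_right ?_ ?_
    · rw [Nat.Coprime, hk1.gcd_eq]
      exact Nat.Coprime.pow_right _ (by simp)
    · rw [Nat.Coprime, hk2.gcd_eq, Nat.gcd_one_left]
  obtain ⟨τ, hτ⟩ := exists_galois_pow hkM
  have hkp : k ≡ 1 [MOD p * n'] := by
    rw [← Nat.modEq_and_modEq_iff_modEq_mul ((Nat.Prime.coprime_iff_not_dvd hp).2 hpn')]
    refine ⟨(hk1.of_dvd (dvd_pow_self p b.succ_ne_zero)).trans ?_, hk2⟩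
    simp [Nat.ModEq]
  have hdvd : n ∣ p ^ (b + 1) * n' :=
    hnn'.trans (mul_dvd_mul_right (dvd_pow_self p b.succ_ne_zero) n')
  refine ⟨k, hk1, cycField (p ^ (b + 1) * n'), (cycField (p ^ (b + 1) * n')).val.toRingHom.comp
    τ.toRingEquiv.toRingHom, fun x => ?_, fun ζ hζ => ?_⟩
  · let z : cycField (p ^ (b + 1) * n') := ⟨χ x, cycField_le hn.ne' hdvd (hval x)⟩
    refine ⟨z, rfl, ?_⟩
    exact congrArg Subtype.val (galois_apply_eq_self hn.ne' hdvd hτ (hkp.of_dvd hnn') (hval x))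
  · have hζ2 : ζ ^ (p ^ (b + 1) * n') = 1 := by rw [pow_mul, hζ, one_pow]
    let z : cycField (p ^ (b + 1) * n') := ⟨ζ, mem_cycField_of_pow_eq_one hζ2⟩
    refine ⟨z, rfl, ?_⟩
    exact congrArg Subtype.val (hτ z (Subtype.ext hζ2))

/-- `Gal(ℚ_L / ℚ_n)` for `n ∣ L`. -/
def fixingRoots (L n : ℕ) : Set (cycField L ≃ₐ[ℚ] cycField L) :=
  {σ | ∀ ξ, ξ ^ n = 1 → σ ξ = ξ}

/-- The conductor `n` in the definition need not divide p^(a+1)m, so for the forward direction σ is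
extended to a larger cyclotomic field by an automorphism that is trivial on ℚ_n. The converse is the
Galois correspondence. -/
theorem isAlmostRational_iff {X : Type*} {χ : X → ℂ} {p a m : ℕ} (hp : p.Prime) (hm : m ≠ 0)
    (hpm : ¬ p ∣ m) (hχ : ∀ x, χ x ∈ cycField (p ^ (a + 1) * m)) :
    IsAlmostRational p χ ↔
      ∀ σ ∈ fixingRoots (p ^ (a + 1) * m) (p * m), IsGaloisConj σ χ χ := by
  have hL : NeZero (p ^ (a + 1) * m) := ⟨mul_ne_zero (pow_ne_zero _ hp.ne_zero) hm⟩
  have hpm0 : NeZero (p * m) := ⟨mul_ne_zero hp.ne_zero hm⟩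
  have hζ := isPrimitiveRoot_cycGen (p ^ (a + 1) * m)
  have hζ' : IsPrimitiveRoot (cycGen (p ^ (a + 1) * m) ^ p ^ a) (p * m) :=
    hζ.pow hL.pos (by ring)
  constructor
  · rintro ⟨n, hn, hpn, hval⟩ σ hσ x
    refine ⟨⟨χ x, hχ x⟩, rfl, ?_⟩
    obtain ⟨n', hn0, hpn', hnn'⟩ := exists_dvd_prime_mul hn hpn
    obtain ⟨k, hkL, hk⟩ := exists_pow_of_galois σ
    have hkpm : k ≡ 1 [MOD p * m] := by
      have h1 := hσ _ hζ'.pow_eq_one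
      rw [hk _ (pow_eq_one_of_exponent_dvd hζ'.pow_eq_one
        (mul_dvd_mul_right (dvd_pow_self p a.succ_ne_zero) m))] at h1
      have h2 := (hζ'.isOfFinOrder hpm0.ne).pow_inj_mod.1 (h1.trans (pow_one _).symm)
      rwa [← hζ'.eq_orderOf] at h2
    have hpmn : ¬ p ∣ m * n' := fun h => (hp.dvd_mul.1 h).elim hpm hpn'
    have hcop : (p ^ (a + 1)).Coprime (m * n') :=
      Nat.Coprime.pow_left _ ((Nat.Prime.coprime_iff_not_dvd hp).2 hpmn)
    -- The exponent `k'` agrees with `k` modulo p^(a+1)m, because `k` is already 1 modulo `m`; it is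
    -- also 1 modulo `p * n'`.
    obtain ⟨k', hk1, hk2⟩ := Nat.chineseRemainder hcop k 1
    have hM : NeZero (p ^ (a + 1) * (m * n')) :=
      ⟨mul_ne_zero (pow_ne_zero _ hp.ne_zero) (mul_ne_zero hm hn0)⟩
    have hk'M : k'.Coprime (p ^ (a + 1) * (m * n')) := by
      refine Nat.Coprime.mul_right ?_ ?_
      · rw [Nat.Coprime, hk1.gcd_eq]
        exact Nat.Coprime.coprime_mul_right_right hkL
      · rw [Nat.Coprime, hk2.gcd_eq, Nat.gcd_one_left]
    obtain ⟨τ, hτ⟩ := exists_galois_pow hk'M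
    have hk'p : k' ≡ 1 [MOD p * n'] := by
      rw [← Nat.modEq_and_modEq_iff_modEq_mul ((Nat.Prime.coprime_iff_not_dvd hp).2 hpn')]
      exact ⟨(hk1.of_dvd (dvd_pow_self p a.succ_ne_zero)).trans (hkpm.of_dvd (dvd_mul_right p m)),
        hk2.of_dvd (dvd_mul_left n' m)⟩
    have hk'k : k' ≡ k [MOD p ^ (a + 1) * m] := by
      rw [← Nat.modEq_and_modEq_iff_modEq_mul
        (Nat.Coprime.pow_left _ ((Nat.Prime.coprime_iff_not_dvd hp).2 hpm))]
      exact ⟨hk1, (hk2.of_dvd (dvd_mul_right m n')).trans (hkpm.of_dvd (dvd_mul_left m p)).symm⟩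
    have hLM : p ^ (a + 1) * m ∣ p ^ (a + 1) * (m * n') :=
      mul_dvd_mul_left _ (dvd_mul_right m n')
    have hdvd : n ∣ p ^ (a + 1) * (m * n') :=
      hnn'.trans (mul_dvd_mul (dvd_pow_self p a.succ_ne_zero) (dvd_mul_left n' m))
    let i : cycField (p ^ (a + 1) * m) →ₐ[ℚ] cycField (p ^ (a + 1) * (m * n')) :=
      IntermediateField.inclusion (cycField_le hL.ne hLM)
    have h := cycField_ringHom_ext
      (f := ((cycField (p ^ (a + 1) * (m * n'))).val.comp τ.toAlgHom).comp i)
      (g := (cycField (p ^ (a + 1) * m)).val.comp σ.toAlgHom) (by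
        have h1 : (i (cycGen _)) ^ (p ^ (a + 1) * m) = 1 := by
          rw [← map_pow, hζ.pow_eq_one, map_one]
        have h2 : (i (cycGen _)) ^ (p ^ (a + 1) * (m * n')) = 1 :=
          pow_eq_one_of_exponent_dvd h1 hLM
        change ((τ (i (cycGen _)) : cycField _) : ℂ) = (σ (cycGen _) : ℂ)
        rw [hτ _ h2, hk _ hζ.pow_eq_one, pow_eq_pow_of_modEq hk'k h1]
        rfl)
    have h3 := DFunLike.congr_fun h ⟨χ x, hχ x⟩
    have h4 := galois_apply_eq_self (z := i ⟨χ x, hχ x⟩) hn.ne' hdvd hτ (hk'p.of_dvd hnn') (hval x)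
    exact h3.symm.trans (congrArg Subtype.val h4)
  · intro h
    refine ⟨p * m, hpm0.pos, fun hd => hpm ?_, fun x => ?_⟩
    · rw [pow_two] at hd
      exact Nat.dvd_of_mul_dvd_mul_left hp.pos hd
    · have hG : IsGalois ℚ (cycField (p ^ (a + 1) * m)) :=
        IsCyclotomicExtension.isGalois {p ^ (a + 1) * m} ℚ _
      let F := IntermediateField.adjoin ℚ {cycGen (p ^ (a + 1) * m) ^ p ^ a}
      have hz : (⟨χ x, hχ x⟩ : cycField (p ^ (a + 1) * m)) ∈ F := by
        rw [← IsGalois.fixedField_fixingSubgroup F, IntermediateField.mem_fixedField_iff]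
        intro σ hσ
        obtain ⟨z, hz1, hz2⟩ := h σ (fun ξ hξ => by
          obtain ⟨j, -, rfl⟩ := hζ'.eq_pow_of_pow_eq_one hξ
          have := (IntermediateField.mem_fixingSubgroup_iff F σ).1 hσ _
            (IntermediateField.mem_adjoin_simple_self _ _)
          rw [map_pow, this]) x
        have h1 : z = ⟨χ x, hχ x⟩ := Subtype.ext hz1
        rw [h1] at hz2
        exact Subtype.ext hz2
      have hF : ∀ y ∈ F, (y : ℂ) ∈ cycField (p * m) := fun y hy => by
        induction hy using IntermediateField.adjoin_induction with
        | mem x hx =>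
          obtain rfl := hx
          apply mem_cycField_of_pow_eq_one
          exact congrArg Subtype.val hζ'.pow_eq_one
        | algebraMap x =>
          exact (cycField (p * m)).algebraMap_mem x
        | add x y _ _ hx hy => exact add_mem hx hy
        | inv x _ hx => exact inv_mem hx
        | mul x y _ _ hx hy => exact mul_mem hx hy
      exact hF _ hz

theorem fixingRoots_subset_navarroGroup {p a m : ℕ} (hp : p.Prime) (hm : m ≠ 0) :
    fixingRoots (p ^ (a + 1) * m) (p * m) ⊆ navarroGroup p (p ^ (a + 1) * m) := by
  have hL : NeZero (p ^ (a + 1) * m) := ⟨mul_ne_zero (pow_ne_zero _ hp.ne_zero) hm⟩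
  intro σ hσ
  have hσ' : ∀ ξ : cycField (p ^ (a + 1) * m), ξ ^ m = 1 → σ ξ = ξ := fun ξ hξ =>
    hσ ξ (pow_eq_one_of_exponent_dvd hξ (dvd_mul_left m p))
  -- The power of `p` is q = 1: such automorphisms fix every root of unity of order prime to `p`.
  refine ⟨0, fun ξ hξ => ?_⟩
  rw [pow_zero, pow_one]
  have h0 : NeZero (orderOf ξ) := ⟨fun h => hξ (h ▸ dvd_zero p)⟩
  have h1 := NumberField.Units.dvd_torsionOrder_of_isPrimitiveRoot (IsPrimitiveRoot.orderOf ξ)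
  rw [IsCyclotomicExtension.Rat.torsionOrder_eq (n := p ^ (a + 1) * m)] at h1
  have hcop : (orderOf ξ).Coprime (p ^ (a + 1)) :=
    Nat.Coprime.pow_right _ ((Nat.Prime.coprime_iff_not_dvd hp).2 hξ).symm
  split_ifs at h1 with he
  · exact hσ' ξ (orderOf_dvd_iff_pow_eq_one.1 (hcop.dvd_of_dvd_mul_left h1))
  -- When p^(a+1)m is odd the field also contains -1, so the order of ξ only divides 2m; then ξ or
  -- -ξ is an `m`-th root of unity.
  · have hmo : Odd m := by
      rw [Nat.not_even_iff_odd, Nat.odd_mul] at he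
      exact he.2
    rw [mul_left_comm] at h1
    have h2 := orderOf_dvd_iff_pow_eq_one.1 (hcop.dvd_of_dvd_mul_left h1)
    rw [pow_mul', sq_eq_one_iff] at h2
    rcases h2 with h2 | h2
    · exact hσ' ξ h2
    · have h3 := hσ' (-ξ) (by rw [hmo.neg_pow, h2, neg_neg])
      rwa [map_neg, neg_inj] at h3

end Cyclotomic

/-! ### Congruences modulo maximal ideals over `p`. -/

section Integers

theorem not_isUnit_natCast_integralClosure {p : ℕ} (hp : p.Prime) :
    ¬ IsUnit (p : integralClosure ℤ ℂ) := by
  intro h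
  obtain ⟨y, hy⟩ := h.exists_right_inv
  have hp0 : (p : ℂ) ≠ 0 := Nat.cast_ne_zero.2 hp.ne_zero
  have h1 : (y : ℂ) = algebraMap ℚ ℂ (1 / p) := by
    have := congrArg Subtype.val hy
    push_cast at this
    rw [map_div₀, map_one, map_natCast, eq_div_iff hp0, mul_comm]
    exact this
  have h2 : IsIntegral ℤ (y : ℂ) := y.2
  rw [h1, isIntegral_algebraMap_iff (algebraMap ℚ ℂ).injective,
    IsIntegrallyClosed.isIntegral_iff] at h2
  obtain ⟨z, hz⟩ := h2
  rw [eq_div_iff (Nat.cast_ne_zero.2 hp.ne_zero), eq_intCast] at hz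
  have h3 : z * (p : ℤ) = 1 := by exact_mod_cast hz
  exact hp.one_lt.ne' (by exact_mod_cast Int.eq_one_of_mul_eq_one_left (by positivity) h3)

theorem exists_maximal_natCast_mem {p : ℕ} (hp : p.Prime) :
    ∃ M : Ideal (integralClosure ℤ ℂ), M.IsMaximal ∧ (p : integralClosure ℤ ℂ) ∈ M :=
  exists_max_ideal_of_mem_nonunits (not_isUnit_natCast_integralClosure hp)

theorem natCast_notMem {R : Type*} [CommRing R] {M : Ideal R} (hM : M ≠ ⊤) {p d : ℕ}
    (hp : p.Prime) (hpM : (p : R) ∈ M) (hd : ¬ p ∣ d) : (d : R) ∉ M := by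
  intro h
  have hc : IsCoprime (p : ℤ) d := Nat.isCoprime_iff_coprime.2 (hp.coprime_iff_not_dvd.2 hd)
  obtain ⟨a, b, hab⟩ := hc
  refine hM ((Ideal.eq_top_iff_one M).2 ?_)
  have h1 := congrArg (Int.cast : ℤ → R) hab
  push_cast at h1
  rw [← h1]
  exact add_mem (M.mul_mem_left _ hpM) (M.mul_mem_left _ h)

/-- Modulo `p` the map y ↦ y^(p^n) is additive, so (x-1)^(p^n) lies in `M`. -/
theorem sub_one_mem_of_pow_eq_one {R : Type*} [CommRing R] {M : Ideal R} [M.IsPrime] {p : ℕ}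
    (hp : p.Prime) (hpM : (p : R) ∈ M) {n : ℕ} {x : R} (hx : x ^ p ^ n = 1) : x - 1 ∈ M := by
  obtain ⟨r, hr⟩ := exists_add_pow_prime_pow_eq hp (x - 1) 1 n
  rw [sub_add_cancel, hx, one_pow] at hr
  have h1 : (x - 1) ^ p ^ n = p * (-((x - 1) * r)) := by linear_combination -hr
  exact Ideal.IsPrime.mem_of_pow_mem ‹_› _ (h1 ▸ M.mul_mem_right _ hpM)

/-- On elements of `p`-power order, characters agree with their degree modulo `p`. -/
theorem character_sub_degree_mem {G : Type*} [Group G] [Finite G] {V : Type*} [AddCommGroup V]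
    [Module ℂ V] [FiniteDimensional ℂ V] (ρ : Representation ℂ G V) {p : ℕ} (hp : p.Prime)
    {M : Ideal (integralClosure ℤ ℂ)} [M.IsPrime] (hpM : (p : integralClosure ℤ ℂ) ∈ M)
    {g : G} {n : ℕ} (hg : orderOf g ∣ p ^ n) :
    ∃ a ∈ M, (a : ℂ) = ρ.character g - ρ.character 1 := by
  obtain ⟨s, hs1, hs2, hs3⟩ := exists_roots_of_unity_sum ρ g
  rw [hs3, ← hs1]
  clear hs1 hs3
  induction s using Multiset.induction_on with
  | empty => exact ⟨0, M.zero_mem, by simp⟩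
  | cons μ s ih =>
    obtain ⟨a, ha, ha'⟩ := ih fun ν hν => hs2 ν (Multiset.mem_cons_of_mem hν)
    have h1 : μ ^ p ^ n = 1 := pow_eq_one_of_exponent_dvd (hs2 μ (Multiset.mem_cons_self μ s)) hg
    have h2 : IsIntegral ℤ μ :=
      IsIntegral.of_pow (pow_pos hp.pos n) (by rw [h1]; exact isIntegral_one)
    let x : integralClosure ℤ ℂ := ⟨μ, h2⟩
    refine ⟨x - 1 + a, add_mem (sub_one_mem_of_pow_eq_one hp hpM (Subtype.ext h1)) ha, ?_⟩
    push_cast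
    rw [Multiset.sum_cons, Multiset.card_cons, ha']
    push_cast
    change μ - 1 + _ = _
    ring

end Integers

/-! ### Membership in the principal block. -/

section Blocks

variable {N : Type*} [Group N]

theorem card_carrier_eq_sum [Fintype N] (x : N) [DecidablePred (IsConj x)] :
    Nat.card (ConjClasses.mk x).carrier = (Finset.univ.filter (IsConj x)).card := by
  rw [Nat.card_coe_set_eq, ← Set.ncard_coe_finset]
  congr 1
  ext y
  rw [ConjClasses.mem_carrier_iff_mk_eq, ConjClasses.mk_eq_mk_iff_isConj, isConj_comm,
    Finset.coe_filter_univ]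
  rfl

theorem isIntegral_centralChar [Finite N] {V : Type*} [AddCommGroup V] [Module ℂ V] [FiniteDimensional ℂ V]
    {ρ : Representation ℂ N V} (hρ : ρ.IsIrreducible) (x : N) :
    IsIntegral ℤ (centralChar ρ.character x) := by
  classical
  have := Fintype.ofFinite N
  have hV := ((isIrreducible_iff ρ).1 hρ).1
  have hd : (finrank ℂ V : ℂ) ≠ 0 := by exact_mod_cast finrank_pos.ne'
  let a : N → integralClosure ℤ ℂ := fun y => if IsConj x y then 1 else 0
  obtain ⟨c, hc⟩ := eq_smul_one_of_commute hρ (∑ y, (a y : ℂ) • ρ y) (fun g v => by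
    simp only [LinearMap.sum_apply, LinearMap.smul_apply, map_sum, map_smul]
    refine Fintype.sum_equiv (MulAut.conj g⁻¹).toEquiv _ _ fun y => ?_
    have h1 : a (g⁻¹ * y * g) = a y := by
      have h2 : IsConj y (g⁻¹ * y * g) := isConj_iff.2 ⟨g⁻¹, by simp⟩
      simp only [a, show IsConj x (g⁻¹ * y * g) ↔ IsConj x y from
        ⟨fun h => h.trans h2.symm, fun h => h.trans h2⟩]
    simp only [MulEquiv.toEquiv_eq_coe, MulEquiv.coe_toEquiv, MulAut.conj_apply, inv_inv, h1]
    rw [← Module.End.mul_apply, ← Module.End.mul_apply, ← map_mul, ← map_mul]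
    congr 3; group)
  have h1 := isIntegral_of_sum_smul_eq ρ a c hc
  have h2 := congrArg (LinearMap.trace ℂ V) hc
  rw [map_sum, map_smul, ← Module.End.one_eq_id, LinearMap.trace_one, smul_eq_mul] at h2
  have h3 : ∑ y, LinearMap.trace ℂ V ((a y : ℂ) • ρ y) =
      Nat.card (ConjClasses.mk x).carrier * ρ.character x := by
    rw [card_carrier_eq_sum, ← nsmul_eq_mul, ← Finset.sum_const, Finset.sum_filter]
    refine Finset.sum_congr rfl fun y _ => ?_
    rw [map_smul, smul_eq_mul]
    by_cases h : IsConj x y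
    · obtain ⟨g, rfl⟩ := isConj_iff.1 h
      rw [if_pos h, ← Representation.char_conj ρ x g]
      simp only [a, if_pos h, OneMemClass.coe_one, one_mul, Representation.character]
    · simp only [a, if_neg h, ZeroMemClass.coe_zero, zero_mul]
  rw [centralChar, Representation.char_one, ← h3, h2, mul_div_cancel_right₀ _ hd]
  exact h1

/-- A normal subgroup with a nonzero fixed vector acts trivially. -/
theorem apply_eq_one_of_weightSpace_one {V : Type*} [AddCommGroup V] [Module ℂ V]
    {ρ : Representation ℂ N V} (hρ : ρ.IsIrreducible) {K : Subgroup N} [K.Normal]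
    (h : weightSpace (ρ.comp K.subtype) 1 ≠ ⊥) {x : N} (hx : x ∈ K) : ρ x = 1 := by
  rcases ((isIrreducible_iff ρ).1 hρ).2 (weightSpace (ρ.comp K.subtype) 1)
    (fun g w hw => apply_mem_weightSpace (l := 1) ρ g hw) with h1 | h1
  · exact absurd h1 h
  · ext v
    have h2 : v ∈ weightSpace (ρ.comp K.subtype) 1 := h1 ▸ Submodule.mem_top
    simpa using h2 ⟨x, hx⟩

theorem centralChar_one (x : N) :
    centralChar (fun _ : N => (1 : ℂ)) x = Nat.card (ConjClasses.mk x).carrier := by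
  simp [centralChar]

/-- Without a nonzero `K`-fixed vector, χ sums to zero over `K`. Adding the congruences of central
characters over the classes inside `K` would then put -|K| in `M`. -/
theorem apply_eq_one_of_sameBlock [Finite N] {V : Type*} [AddCommGroup V] [Module ℂ V]
    [FiniteDimensional ℂ V] {ρ : Representation ℂ N V} (hρ : ρ.IsIrreducible) {p : ℕ}
    (hp : p.Prime) (hB : SameBlock p ρ.character (fun _ => 1)) {K : Subgroup N} [K.Normal]
    (hK : ¬ p ∣ Nat.card K) {x : N} (hx : x ∈ K) : ρ x = 1 := by
  classical
  have := Fintype.ofFinite N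
  have := Fintype.ofFinite K
  have hV := ((isIrreducible_iff ρ).1 hρ).1
  have hd : ρ.character 1 ≠ 0 := by
    rw [Representation.char_one]; exact_mod_cast finrank_pos.ne'
  obtain ⟨M, hM, hpM⟩ := exists_maximal_natCast_mem hp
  refine apply_eq_one_of_weightSpace_one hρ (K := K) (fun h0 => ?_) hx
  have h1 := finrank_weightSpace (ρ.comp K.subtype) 1
  rw [h0, finrank_bot, Nat.cast_zero, eq_comm, mul_eq_zero, inv_eq_zero] at h1
  have h2 := h1.resolve_left (Nat.cast_ne_zero.2 Nat.card_pos.ne')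
  have h3 : ∑ y : K, ρ.character y = 0 := by
    rw [← h2]
    exact Finset.sum_congr rfl fun y _ => by rw [MonoidHom.one_apply, one_mul]; rfl
  let f : N → ℂ := fun y => if y ∈ K then ρ.character y / ρ.character 1 - 1 else 0
  have hf : ∑ y, f y = -(Nat.card K : ℂ) := by
    have h4 : ∑ y, f y = ∑ y : K, (ρ.character y / ρ.character 1 - 1) := by
      rw [← Finset.sum_filter]
      exact (Finset.sum_subtype _ (fun y => by simp) _)
    rw [h4, Finset.sum_sub_distrib, ← Finset.sum_div, h3, zero_div, zero_sub]
    simp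
  have key : ∀ C : ConjClasses N,
      ∃ a ∈ M, (a : ℂ) = ∑ y ∈ Finset.univ.filter (fun y => ConjClasses.mk y = C), f y := by
    intro C
    obtain ⟨y, rfl⟩ := ConjClasses.mk_surjective C
    have hconst : ∀ z ∈ Finset.univ.filter (fun z => ConjClasses.mk z = ConjClasses.mk y),
        f z = f y := fun z hz => by
      obtain ⟨g, rfl⟩ := isConj_iff.1 (ConjClasses.mk_eq_mk_iff_isConj.1 (Finset.mem_filter.1 hz).2).symm
      have h5 : g * y * g⁻¹ ∈ K ↔ y ∈ K := (Subgroup.Normal.mem_comm_iff ‹_›).trans (by simp)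
      simp only [f, h5, Representation.char_conj]
    have hcard : (Finset.univ.filter (fun z => ConjClasses.mk z = ConjClasses.mk y)).card =
        Nat.card (ConjClasses.mk y).carrier := by
      rw [card_carrier_eq_sum]
      congr 1
      ext z
      rw [Finset.mem_filter, Finset.mem_filter, ConjClasses.mk_eq_mk_iff_isConj, isConj_comm]
    rw [Finset.sum_congr rfl hconst, Finset.sum_const, hcard, nsmul_eq_mul]
    by_cases hy : y ∈ K
    · obtain ⟨a, ha, ha'⟩ := hB M hM hpM y
      refine ⟨a, ha, ?_⟩
      rw [ha', centralChar_one, centralChar]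
      simp only [f, hy, if_true]
      ring
    · exact ⟨0, M.zero_mem, by simp [f, hy]⟩
  choose a ha ha' using key
  have h6 : ((∑ C, a C : integralClosure ℤ ℂ) : ℂ) = -(Nat.card K : ℂ) := by
    rw [← hf, ← Finset.sum_fiberwise (s := Finset.univ) (g := fun x : N => ConjClasses.mk x)]
    push_cast
    exact Finset.sum_congr rfl fun C _ => ha' C
  have h7 : ∑ C, a C = -(Nat.card K : integralClosure ℤ ℂ) :=
    Subtype.ext (by rw [h6]; push_cast; rfl)
  have h8 : -(Nat.card K : integralClosure ℤ ℂ) ∈ M := h7 ▸ sum_mem fun C _ => ha C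
  exact natCast_notMem hM.ne_top hp hpM hK (neg_mem_iff.1 h8)

/-- `P` acts on the class by conjugation; a fixed point would be a conjugate of `x` centralizing
`P`, and then so would `x`, as `P` is normal. -/
theorem dvd_card_carrier [Finite N] {p : ℕ} [Fact p.Prime] {P : Subgroup N} [P.Normal] (hP : IsPGroup p P)
    {x : N} (hx : x ∉ Subgroup.centralizer (P : Set N)) :
    p ∣ Nat.card (ConjClasses.mk x).carrier := by
  rw [← ConjAct.orbit_eq_carrier_conjClasses]
  let f : P →* ConjAct N := ConjAct.toConjAct.toMonoidHom.comp P.subtype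
  let _ : MulAction P (MulAction.orbit (ConjAct N) x) := MulAction.compHom _ f
  have : Finite (ConjAct N) := ‹Finite N›
  have : Finite (MulAction.orbit (ConjAct N) x) := Set.finite_range _
  have h := hP.card_modEq_card_fixedPoints (MulAction.orbit (ConjAct N) x)
  have h0 : Nat.card (MulAction.fixedPoints P (MulAction.orbit (ConjAct N) x)) = 0 := by
    rw [Nat.card_eq_zero]
    left
    refine ⟨?_⟩
    rintro ⟨⟨_, g, rfl⟩, hy⟩
    refine hx (Subgroup.mem_centralizer_iff.2 fun z hz => ?_)
    let h := ConjAct.ofConjAct g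
    have hz' : h * z * h⁻¹ ∈ P := Subgroup.Normal.conj_mem ‹_› z hz h
    have h1 := congrArg Subtype.val (hy ⟨h * z * h⁻¹, hz'⟩)
    change (h * z * h⁻¹) * (h * x * h⁻¹) * (h * z * h⁻¹)⁻¹ = h * x * h⁻¹ at h1
    have h2 : h * (z * x * z⁻¹) * h⁻¹ = h * x * h⁻¹ := by rw [← h1]; group
    rw [mul_left_inj, mul_right_inj, mul_inv_eq_iff_eq_mul] at h2
    exact h2
  rw [h0] at h
  exact (Nat.modEq_zero_iff_dvd.1 h)

/-- After multiplication by χ(1), a unit modulo `M`, the difference of central characters is |class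
of x|(χ(x) - χ(1)). Off the centralizer of `P` the class size is divisible by `p`; on it χ(x) = χ(z)
with `z` of `p`-power order, so χ(x) ≡ χ(1). -/
theorem sameBlock_one_of_apply_eq_one [Finite N] {V : Type*} [AddCommGroup V] [Module ℂ V]
    [FiniteDimensional ℂ V] {ρ : Representation ℂ N V} (hρ : ρ.IsIrreducible) {p : ℕ}
    [hp : Fact p.Prime] {P : Subgroup N} [P.Normal] (hP : IsPGroup p P)
    (hd : ¬ p ∣ finrank ℂ V)
    (hC : ∀ x ∈ Subgroup.centralizer (P : Set N), ∃ z ∈ P, ∃ k, ρ k = 1 ∧ x = z * k) :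
    SameBlock p ρ.character (fun _ => 1) := by
  intro M hM hpM x
  have hV := ((isIrreducible_iff ρ).1 hρ).1
  have hd0 : (finrank ℂ V : ℂ) ≠ 0 := by exact_mod_cast finrank_pos.ne'
  let c := Nat.card (ConjClasses.mk x).carrier
  let w : integralClosure ℤ ℂ := ⟨centralChar ρ.character x, isIntegral_centralChar hρ x⟩
  refine ⟨w - c, ?_, by rw [centralChar_one]; push_cast; rfl⟩
  have hMp := hM.isPrime
  refine (hMp.mem_or_mem (y := (finrank ℂ V : integralClosure ℤ ℂ)) ?_).resolve_right
    (natCast_notMem hM.ne_top hp.out hpM hd)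
  let y : integralClosure ℤ ℂ := ⟨ρ.character x, isIntegral_character ρ x⟩
  have h1 : (w - c) * (finrank ℂ V : integralClosure ℤ ℂ) =
      c * (y - (finrank ℂ V : integralClosure ℤ ℂ)) := by
    apply Subtype.ext
    push_cast
    change (centralChar ρ.character x - c) * _ = c * (ρ.character x - _)
    rw [centralChar, Representation.char_one]
    change (c * ρ.character x / finrank ℂ V - c) * _ = _
    field_simp
  rw [h1]
  by_cases hx : x ∈ Subgroup.centralizer (P : Set N)
  · obtain ⟨z, hz, k, hk, rfl⟩ := hC x hx
    refine M.mul_mem_left _ ?_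
    obtain ⟨n, hn⟩ := (IsPGroup.iff_orderOf.1 hP) ⟨z, hz⟩
    rw [Subgroup.orderOf_mk] at hn
    obtain ⟨a, ha, ha'⟩ := character_sub_degree_mem ρ hp.out hpM hn.dvd
    have h2 : y - (finrank ℂ V : integralClosure ℤ ℂ) = a := by
      apply Subtype.ext
      rw [ha', Representation.char_one]
      push_cast
      congr 1
      change LinearMap.trace ℂ V (ρ (z * k)) = LinearMap.trace ℂ V (ρ z)
      rw [map_mul, hk, mul_one]
    rwa [h2]
  · refine M.mul_mem_right _ ?_
    obtain ⟨j, hj⟩ := dvd_card_carrier hP hx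
    change ((Nat.card (ConjClasses.mk x).carrier : ℕ) : integralClosure ℤ ℂ) ∈ M
    rw [hj]
    push_cast
    exact M.mul_mem_right _ hpM

end Blocks

/-! ### Frattini quotients and coprime action on a normal Sylow subgroup. -/

section GroupTheory

variable {N : Type*} [Group N] {p : ℕ}

theorem eq_one_of_pow_coprime {G : Type*} [Group G] {x : G} {m n : ℕ} (hmn : m.Coprime n)
    (hm : x ^ m = 1) (hn : x ^ n = 1) : x = 1 := by
  have h := Nat.dvd_gcd (orderOf_dvd_of_pow_eq_one hm) (orderOf_dvd_of_pow_eq_one hn)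
  rw [hmn.gcd_eq_one, Nat.dvd_one, orderOf_eq_one_iff] at h
  exact h

theorem card_coprime_of_isPGroup [Finite N] [hp : Fact p.Prime] {P : Subgroup N} (hP : IsPGroup p P) {n : ℕ}
    (hn : ¬ p ∣ n) : (Nat.card P).Coprime n := by
  obtain ⟨k, hk⟩ := hP.exists_card_eq
  rw [hk]
  exact Nat.Coprime.pow_left k ((Nat.Prime.coprime_iff_not_dvd hp.out).2 hn)

/-- The normal `p`-complement of the centralizer of a normal Sylow `p`-subgroup. -/
theorem exists_normal_complement_centralizer [Finite N] [Fact p.Prime] {P : Subgroup N} [P.Normal]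
    (hP : IsPGroup p P) (hi : ¬ p ∣ P.index) :
    ∃ K : Subgroup N, K.Normal ∧ ¬ p ∣ Nat.card K ∧
      ∀ x ∈ Subgroup.centralizer (P : Set N), ∃ z ∈ P, ∃ k ∈ K, x = z * k := by
  let C := Subgroup.centralizer (P : Set N)
  have hpi : ¬ p ∣ (P.subgroupOf C).index := fun h =>
    hi (h.trans (Subgroup.relIndex_dvd_index_of_normal P C))
  have hcop : (Nat.card (P.subgroupOf C)).Coprime (P.subgroupOf C).index :=
    card_coprime_of_isPGroup (hP.comap_of_injective C.subtype C.subtype_injective) hpi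
  obtain ⟨K0, hK0⟩ := Subgroup.exists_right_complement'_of_coprime hcop
  have hK0c : Nat.card K0 = (P.subgroupOf C).index := hK0.symm.index_eq_card.symm
  have hKc : Nat.card (K0.map C.subtype) = (P.subgroupOf C).index := by
    rw [← hK0c]
    exact Subgroup.card_map_of_injective C.subtype_injective
  have hdec : ∀ x ∈ C, ∃ z ∈ P, ∃ k ∈ K0.map C.subtype, x = z * k := fun x hx => by
    obtain ⟨⟨z, k⟩, h⟩ := hK0.2 ⟨x, hx⟩
    exact ⟨z.1, z.2, k.1, ⟨k.1, k.2, rfl⟩, (congrArg Subtype.val h).symm⟩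
  refine ⟨K0.map C.subtype, ⟨fun k hk g => ?_⟩, hKc ▸ hpi, hdec⟩
  have hkC : k ∈ C := by
    obtain ⟨k0, -, rfl⟩ := hk
    exact k0.2
  have hpow : ∀ y ∈ K0.map C.subtype, y ^ (P.subgroupOf C).index = 1 := fun y hy => by
    have := pow_card_eq_one' (x := (⟨y, hy⟩ : K0.map C.subtype))
    rw [hKc] at this
    exact congrArg Subtype.val this
  -- For normality, `z` commutes with `k'`, so its order divides the order of the complement as well
  -- as that of `P`; hence z = 1.
  obtain ⟨z, hz, k', hk', h⟩ := hdec (g * k * g⁻¹) ((inferInstance : C.Normal).conj_mem k hkC g)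
  have hk'C : k' ∈ C := by
    obtain ⟨k0, -, rfl⟩ := hk'
    exact k0.2
  have hcomm : Commute z k' := Subgroup.mem_centralizer_iff.1 hk'C z hz
  have h1 : z ^ (P.subgroupOf C).index = 1 := by
    have h2 := congrArg (· ^ (P.subgroupOf C).index) h
    simp only [conj_pow, hpow k hk, mul_one, mul_inv_cancel, hcomm.mul_pow, hpow k' hk'] at h2
    exact h2.symm
  have h3 : z ^ Nat.card P = 1 :=
    congrArg Subtype.val (pow_card_eq_one' (x := (⟨z, hz⟩ : P)))
  rw [h, eq_one_of_pow_coprime (card_coprime_of_isPGroup hP hpi) h3 h1, one_mul]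
  exact hk'

/-- The subgroup generated by the commutators and `p`-th powers of elements of `P`. -/
def commPowSubgroup (p : ℕ) {N : Type*} [Group N] (P : Subgroup N) : Subgroup N :=
  Subgroup.closure {x | ∃ a ∈ P, ∃ b ∈ P, x = a * b * a⁻¹ * b⁻¹ ∨ x = a ^ p}

theorem commutator_mem_commPowSubgroup {P : Subgroup N} {a b : N} (ha : a ∈ P) (hb : b ∈ P) :
    a * b * a⁻¹ * b⁻¹ ∈ commPowSubgroup p P := Subgroup.subset_closure ⟨a, ha, b, hb, Or.inl rfl⟩

theorem pow_mem_commPowSubgroup {P : Subgroup N} {a : N} (ha : a ∈ P) :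
    a ^ p ∈ commPowSubgroup p P := Subgroup.subset_closure ⟨a, ha, a, ha, Or.inr rfl⟩

theorem commPowSubgroup_le (P : Subgroup N) : commPowSubgroup p P ≤ P := by
  rw [commPowSubgroup, Subgroup.closure_le]
  rintro x ⟨a, ha, b, hb, rfl | rfl⟩
  · exact P.mul_mem (P.mul_mem (P.mul_mem ha hb) (P.inv_mem ha)) (P.inv_mem hb)
  · exact P.pow_mem ha p

instance commPowSubgroup_normal (P : Subgroup N) [hP : P.Normal] :
    (commPowSubgroup p P).Normal := by
  refine ⟨fun n hn g => ?_⟩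
  have h : commPowSubgroup p P ≤ (commPowSubgroup p P).comap (MulAut.conj g).toMonoidHom := by
    conv_lhs => rw [commPowSubgroup]
    rw [Subgroup.closure_le]
    rintro x ⟨a, ha, b, hb, hx⟩
    refine Subgroup.subset_closure
      ⟨g * a * g⁻¹, hP.conj_mem a ha g, g * b * g⁻¹, hP.conj_mem b hb g, ?_⟩
    change g * x * g⁻¹ = _ ∨ g * x * g⁻¹ = _
    rcases hx with rfl | rfl
    · left; group
    · right; rw [conj_pow]
  exact h hn

theorem isCoatom_quotient_card [hp : Fact p.Prime] {P : Type*} [Group P] [Finite P]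
    (hP : IsPGroup p P) {M : Subgroup P} (hM : IsCoatom M) [M.Normal] : Nat.card (P ⧸ M) = p := by
  have hnt : Nontrivial (P ⧸ M) := QuotientGroup.nontrivial_iff.2 hM.1
  have hQ : IsPGroup p (P ⧸ M) := hP.to_quotient M
  obtain ⟨n, hn0, hn⟩ := hQ.nontrivial_iff_card.1 hnt
  obtain ⟨y, hy⟩ := exists_prime_orderOf_dvd_card' (G := P ⧸ M) p (hn ▸ dvd_pow_self p hn0.ne')
  have htop : (Subgroup.zpowers y).comap (QuotientGroup.mk' M) = ⊤ := by
    refine hM.2 _ (lt_of_le_of_ne ?_ fun h => ?_)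
    · intro x hx
      rw [Subgroup.mem_comap, QuotientGroup.mk'_apply, (QuotientGroup.eq_one_iff x).2 hx]
      exact one_mem _
    · obtain ⟨x, rfl⟩ := QuotientGroup.mk_surjective y
      have : x ∈ M := by
        rw [h, Subgroup.mem_comap]
        exact Subgroup.mem_zpowers _
      rw [(QuotientGroup.eq_one_iff x).2 this, orderOf_one] at hy
      exact hp.out.one_lt.ne hy
  have h1 : Subgroup.zpowers y = ⊤ := by
    rw [eq_top_iff]
    intro z _
    obtain ⟨x, rfl⟩ := QuotientGroup.mk_surjective z
    have : x ∈ (Subgroup.zpowers y).comap (QuotientGroup.mk' M) := htop ▸ Subgroup.mem_top x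
    exact this
  rw [← hy, ← Nat.card_zpowers, h1, Subgroup.card_top]

/-- The subgroup generated by commutators and `p`-th powers consists of non-generators. -/
theorem eq_of_forall_eq_mul_commPowSubgroup [Finite N] [hp : Fact p.Prime] {P : Subgroup N}
    (hP : IsPGroup p P) {C : Subgroup N} (hCP : C ≤ P)
    (h : ∀ x ∈ P, ∃ c ∈ C, ∃ d ∈ commPowSubgroup p P, x = c * d) : C = P := by
  -- Maximal subgroups of a `p`-group are normal of index `p`, so they contain all commutators and
  -- `p`-th powers.
  have hD : commPowSubgroup p P ≤ (frattini P).map P.subtype := by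
    rw [commPowSubgroup, Subgroup.closure_le]
    rintro x ⟨a, ha, b, hb, hx⟩
    have hxP : x ∈ P := by
      rcases hx with rfl | rfl
      · exact P.mul_mem (P.mul_mem (P.mul_mem ha hb) (P.inv_mem ha)) (P.inv_mem hb)
      · exact P.pow_mem ha p
    refine ⟨⟨x, hxP⟩, ?_, rfl⟩
    rw [SetLike.mem_coe, frattini, Order.radical, Subgroup.mem_iInf]
    intro M
    rw [Subgroup.mem_iInf]
    intro hM
    have hM' : IsCoatom M := hM
    have hnil : Group.IsNilpotent P := hP.isNilpotent
    have hMn : M.Normal := Subgroup.NormalizerCondition.normal_of_coatom M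
      Group.normalizerCondition_of_isNilpotent hM'
    have hc := isCoatom_quotient_card hP hM'
    have hcyc : IsCyclic (P ⧸ M) := isCyclic_of_prime_card hc
    rw [← QuotientGroup.eq_one_iff]
    rcases hx with rfl | rfl
    · have h1 : ((⟨a * b * a⁻¹ * b⁻¹, hxP⟩ : P) : P ⧸ M) =
          ((⟨a, ha⟩ : P) : P ⧸ M) * ((⟨b, hb⟩ : P) : P ⧸ M) * ((⟨a, ha⟩ : P) : P ⧸ M)⁻¹ *
            ((⟨b, hb⟩ : P) : P ⧸ M)⁻¹ := rfl
      rw [h1, mul_inv_eq_one, mul_inv_eq_iff_eq_mul]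
      obtain ⟨g, hg⟩ := hcyc.exists_generator
      obtain ⟨i, hi⟩ := hg ((⟨a, ha⟩ : P) : P ⧸ M)
      obtain ⟨j, hj⟩ := hg ((⟨b, hb⟩ : P) : P ⧸ M)
      rw [← hi, ← hj]
      exact (Commute.refl g).zpow_zpow i j
    · have h1 : ((⟨a ^ p, hxP⟩ : P) : P ⧸ M) = ((⟨a, ha⟩ : P) : P ⧸ M) ^ p := rfl
      rw [h1, ← hc, pow_card_eq_one']
  have h1 : C.subgroupOf P = ⊤ := by
    apply frattini_nongenerating
    rw [eq_top_iff]
    intro x _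
    obtain ⟨c, hc, d, hd, hx⟩ := h x x.2
    obtain ⟨d', hd', rfl⟩ := hD hd
    have : x = ⟨c, hCP hc⟩ * d' := Subtype.ext hx
    rw [this]
    exact Subgroup.mul_mem_sup hc hd'
  exact le_antisymm hCP (Subgroup.subgroupOf_eq_top.1 h1)

/-- An automorphism of prime order `q ≠ p` that acts trivially modulo non-generators is trivial. -/
theorem mem_centralizer_of_pow_mem [Finite N] [hp : Fact p.Prime] {P : Subgroup N} [P.Normal]
    (hP : IsPGroup p P) {x : N} {q : ℕ} [hq : Fact q.Prime] (hqp : q ≠ p)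
    (hx : ∀ a ∈ P, a⁻¹ * (x * a * x⁻¹) ∈ commPowSubgroup p P)
    (hxq : x ^ q ∈ Subgroup.centralizer (P : Set N)) : x ∈ Subgroup.centralizer (P : Set N) := by
  classical
  have key := eq_of_forall_eq_mul_commPowSubgroup hP
    (C := P ⊓ Subgroup.centralizer {x}) inf_le_left (fun a ha => by
      let D := commPowSubgroup p P
      have hDn : D.Normal := commPowSubgroup_normal P
      -- Conjugation by `x` acts on the coset aD with order dividing `q`. The coset has `p`-power
      -- size, so it contains a fixed point; hence P = C_P(x)D, and `D` can be dropped.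
      let X := {y : N // a⁻¹ * y ∈ D}
      have hXP : ∀ y : X, y.1 ∈ P := fun y => by
        have := P.mul_mem ha (commPowSubgroup_le P y.2)
        rwa [mul_inv_cancel_left] at this
      have : Fintype X := Fintype.ofFinite X
      let f : Function.End X := fun y => ⟨x * y.1 * x⁻¹, by
        have h1 := hx y.1 (hXP y)
        have h2 := D.mul_mem y.2 h1
        rwa [mul_assoc, mul_inv_cancel_left] at h2⟩
      have hf : ∀ (j : ℕ) y, ((f ^ j) y).1 = x ^ j * y.1 * (x ^ j)⁻¹ := by
        intro j
        induction j with
        | zero => intro y; simp [Function.End.one_def]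
        | succ j ih =>
          intro y
          rw [pow_succ]
          change ((f ^ j) (f y)).1 = _
          rw [ih]
          change x ^ j * (x * y.1 * x⁻¹) * (x ^ j)⁻¹ = _
          group
      have hf1 : f ^ q ^ 1 = 1 := by
        funext y
        apply Subtype.ext
        rw [hf, pow_one, ← Subgroup.mem_centralizer_iff.1 hxq y.1 (hXP y), mul_inv_cancel_right]
        rfl
      have hcard := Equiv.Perm.card_fixedPoints_modEq hf1
      have hX : Fintype.card X = Nat.card D := by
        rw [← Nat.card_eq_fintype_card]
        exact Nat.card_congr ((Equiv.mulLeft a⁻¹).subtypeEquiv fun y => Iff.rfl)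
      have hfix : Fintype.card f.fixedPoints ≠ 0 := by
        intro h0
        rw [h0, hX] at hcard
        have h1 := (Nat.modEq_zero_iff_dvd.1 hcard).trans (Subgroup.card_dvd_of_le (commPowSubgroup_le P))
        obtain ⟨k, hk⟩ := hP.exists_card_eq
        rw [hk] at h1
        exact hqp ((Nat.prime_dvd_prime_iff_eq hq.out hp.out).1 (hq.out.dvd_of_dvd_pow h1))
      obtain ⟨y, hy⟩ := Fintype.card_pos_iff.1 (Nat.pos_of_ne_zero hfix)
      refine ⟨y.1, ⟨hXP y, ?_⟩, (a⁻¹ * y.1)⁻¹, D.inv_mem y.2, by group⟩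
      have h2 : x * y.1 * x⁻¹ = y.1 := congrArg Subtype.val hy
      change y.1 ∈ Subgroup.centralizer {x}
      rw [Subgroup.mem_centralizer_singleton_iff]
      exact (mul_inv_eq_iff_eq_mul.1 h2).symm)
  rw [Subgroup.mem_centralizer_iff]
  intro a ha
  rw [← key] at ha
  exact (Subgroup.mem_centralizer_singleton_iff.1 ha.2)

theorem conj_pow_mem_commPowSubgroup {P : Subgroup N} [hPn : P.Normal] {x : N}
    (hx : ∀ a ∈ P, a⁻¹ * (x * a * x⁻¹) ∈ commPowSubgroup p P) (n : ℕ) :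
    ∀ a ∈ P, a⁻¹ * (x ^ n * a * (x ^ n)⁻¹) ∈ commPowSubgroup p P := by
  induction n with
  | zero => intro a _; simp [one_mem]
  | succ n ih =>
    intro a ha
    have h1 := Subgroup.mul_mem _ (hx a ha) (ih _ (hPn.conj_mem a ha x))
    rw [mul_assoc, mul_inv_cancel_left] at h1
    rw [pow_succ]
    convert h1 using 2
    group

/-- Prime factors of the order are removed one at a time: the power `x ^ q` centralizes `P` by
induction, so `x` induces an automorphism of order dividing `q`. -/
theorem mem_centralizer_of_coprime_orderOf [Finite N] [hp : Fact p.Prime] {P : Subgroup N} [P.Normal]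
    (hP : IsPGroup p P) (r : ℕ) : ∀ {x : N}, orderOf x = r → ¬ p ∣ r →
      (∀ a ∈ P, a⁻¹ * (x * a * x⁻¹) ∈ commPowSubgroup p P) →
      x ∈ Subgroup.centralizer (P : Set N) := by
  induction r using Nat.strong_induction_on with
  | _ r ih =>
  intro x hr hpr hx
  by_cases h1 : r = 1
  · rw [h1, orderOf_eq_one_iff] at hr
    rw [hr]
    exact one_mem _
  · have hq := Nat.minFac_prime h1
    have : Fact r.minFac.Prime := ⟨hq⟩
    have hr0 : 0 < r := hr ▸ orderOf_pos x
    have hqr : r.minFac ≠ p := fun h => hpr (h ▸ Nat.minFac_dvd r)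
    have ho : orderOf (x ^ r.minFac) = r / r.minFac := by
      rw [orderOf_pow_of_dvd hq.ne_zero (hr ▸ Nat.minFac_dvd r), hr]
    exact mem_centralizer_of_pow_mem hP hqr hx
      (ih _ (Nat.div_lt_self hr0 hq.one_lt) ho
        (fun h => hpr (h.trans (Nat.div_dvd_of_dvd (Nat.minFac_dvd r))))
        (conj_pow_mem_commPowSubgroup hx _))

/-- An element acting trivially on `P` modulo non-generators lies in `P` times the centralizer
of `P`. -/
theorem mem_sup_of_conj_mem_commPowSubgroup [Finite N] [hp : Fact p.Prime] {P K : Subgroup N} [P.Normal]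
    [K.Normal] (hP : IsPGroup p P) (hi : ¬ p ∣ P.index)
    (hK : ∀ x ∈ Subgroup.centralizer (P : Set N), ∃ z ∈ P, ∃ k ∈ K, x = z * k) {x : N}
    (hx : ∀ a ∈ P, a⁻¹ * (x * a * x⁻¹) ∈ commPowSubgroup p P) : x ∈ P ⊔ K := by
  obtain ⟨j, r, hr, ho⟩ := Nat.exists_eq_pow_mul_and_not_dvd (orderOf_pos x).ne' p hp.out.ne_one
  have h1 : orderOf (x ^ p ^ j) = r := by
    rw [orderOf_pow_of_dvd (pow_ne_zero _ hp.out.ne_zero) (ho ▸ dvd_mul_right _ _), ho,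
      Nat.mul_div_cancel_left _ (pow_pos hp.out.pos j)]
  have h2 := mem_centralizer_of_coprime_orderOf hP r h1 hr (conj_pow_mem_commPowSubgroup hx _)
  have h3 : x ^ p ^ j ∈ P ⊔ K := by
    obtain ⟨z, hz, k, hk, h⟩ := hK _ h2
    rw [h]
    exact Subgroup.mul_mem_sup hz hk
  -- Modulo PK the element is killed by p^j and by the index of `P`, which are coprime.
  have h4 : x ^ P.index ∈ P ⊔ K := (le_sup_left : P ≤ P ⊔ K) (P.pow_index_mem x)
  rw [← QuotientGroup.eq_one_iff] at h3 h4 ⊢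
  rw [QuotientGroup.mk_pow] at h3 h4
  exact eq_one_of_pow_coprime (Nat.Coprime.pow_left j (hp.out.coprime_iff_not_dvd.2 hi)) h3 h4

end GroupTheory

/-! ### Class numbers of groups with a self-centralizing elementary abelian Sylow subgroup. -/

section ClassNumbers

theorem classNumber_congr {G H : Type*} [Group G] [Group H] [Finite G] (e : G ≃* H) :
    classNumber G = classNumber H := by
  have : Finite H := Finite.of_equiv G e.toEquiv
  refine le_antisymm ?_ ?_
  · exact Nat.card_le_card_of_surjective (ConjClasses.map e.symm.toMonoidHom)
      (ConjClasses.map_surjective e.symm.surjective)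
  · exact Nat.card_le_card_of_surjective (ConjClasses.map e.toMonoidHom)
      (ConjClasses.map_surjective e.surjective)

variable {Y : Type*} [Group Y] {V : Subgroup Y} [V.Normal]

theorem ker_conjNormal (V : Subgroup Y) [V.Normal] :
    (MulAut.conjNormal (H := V)).ker = Subgroup.centralizer (V : Set Y) := by
  ext y
  rw [MonoidHom.mem_ker, Subgroup.mem_centralizer_iff]
  constructor
  · intro h v hv
    have h1 := congrArg Subtype.val (DFunLike.congr_fun h ⟨v, hv⟩)
    simp only [MulAut.conjNormal_apply, MulAut.one_apply] at h1
    exact (mul_inv_eq_iff_eq_mul.1 h1).symm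
  · intro h
    ext v
    rw [MulAut.conjNormal_apply, ← h v v.2, mul_inv_cancel_right]
    rfl

/-- The centralizer of `x` is a complement of `V`. As Y/V embeds in the abelian group Aut(V), all
commutators [y,x] lie in `V`; and v ↦ [v,x] is injective, hence bijective, on `V`, so every `y` can
be corrected by some `v` to commute with `x`. -/
theorem card_centralizer_of_notMem [Finite Y] {p : ℕ} (hp : p.Prime) (hV : Nat.card V = p)
    (hC : Subgroup.centralizer (V : Set Y) = V) {x : Y} (hx : x ∉ V) :
    Nat.card (Subgroup.centralizer {x}) = V.index := by
  have hcyc : IsCyclic V := have := Fact.mk hp; isCyclic_of_prime_card hV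
  have hinj : ∀ v ∈ V, v * x = x * v → v = 1 := by
    intro v hv hvx
    by_contra hv1
    have hz : ∀ w ∈ V, ∃ i : ℤ, v ^ i = w := by
      have := Fact.mk hp
      have h1 : (⟨v, hv⟩ : V) ≠ 1 := fun h => hv1 (congrArg Subtype.val h)
      intro w hw
      obtain ⟨i, hi⟩ := mem_zpowers_of_prime_card hV h1 (g' := ⟨w, hw⟩)
      exact ⟨i, congrArg Subtype.val hi⟩
    apply hx
    rw [← hC, Subgroup.mem_centralizer_iff]
    intro w hw
    obtain ⟨i, rfl⟩ := hz w hw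
    exact (Commute.zpow_left hvx i)
  have hcomm : ∀ y : Y, y * x * y⁻¹ * x⁻¹ ∈ V := by
    intro y
    have hker : (MulAut.conjNormal (H := V)).ker = V := (ker_conjNormal V).trans hC
    rw [← hker, MonoidHom.mem_ker]
    have hab : ∀ a b : MulAut V, a * b = b * a := fun a b => by
      apply (IsCyclic.mulAutMulEquiv V).injective
      rw [map_mul, map_mul, mul_comm]
    rw [map_mul, map_mul, map_mul, hab (MulAut.conjNormal y)]
    simp
  let f : V → V := fun v => ⟨v * x * (v : Y)⁻¹ * x⁻¹, hcomm v⟩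
  have hf : Function.Surjective f := by
    apply Finite.surjective_of_injective
    intro v w hvw
    have h1 : (v : Y) * x * (v : Y)⁻¹ * x⁻¹ = w * x * (w : Y)⁻¹ * x⁻¹ := congrArg Subtype.val hvw
    rw [mul_left_inj, mul_inv_eq_iff_eq_mul] at h1
    have h2 := hinj ((w : Y)⁻¹ * v) (V.mul_mem (V.inv_mem w.2) v.2) (by
      rw [mul_assoc, h1]; group)
    exact Subtype.ext (inv_mul_eq_one.1 h2).symm
  have hcompl : V.IsComplement' (Subgroup.centralizer {x}) := by
    apply Subgroup.isComplement'_of_disjoint_and_mul_eq_univ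
    · rw [Subgroup.disjoint_def]
      intro v hv hvx
      exact hinj v hv (Subgroup.mem_centralizer_singleton_iff.1 hvx)
    · refine Set.eq_univ_of_forall fun y => ?_
      obtain ⟨v, hv⟩ := hf ⟨_, hcomm y⟩
      have h1 : (v : Y) * x * (v : Y)⁻¹ * x⁻¹ = y * x * y⁻¹ * x⁻¹ := congrArg Subtype.val hv
      rw [mul_left_inj, mul_inv_eq_iff_eq_mul] at h1
      refine ⟨v, v.2, (v : Y)⁻¹ * y, ?_, mul_inv_cancel_left _ _⟩
      rw [SetLike.mem_coe, Subgroup.mem_centralizer_singleton_iff]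
      have h2 : y⁻¹ * v * x = x * (y⁻¹ * v) := by
        rw [mul_assoc, h1]; group
      calc (v : Y)⁻¹ * y * x = (v : Y)⁻¹ * y * (x * (y⁻¹ * v)) * ((v : Y)⁻¹ * y) := by group
        _ = x * ((v : Y)⁻¹ * y) := by rw [← h2]; group
  exact hcompl.symm.index_eq_card.symm

theorem classNumber_mem_cyclicSet [Finite Y] {p : ℕ} (hp : p.Prime) (hV : Nat.card V = p)
    (hC : Subgroup.centralizer (V : Set Y) = V) : classNumber Y ∈ cyclicSet p := by
  classical
  have := Fact.mk hp
  have := Fintype.ofFinite Y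
  have hcyc : IsCyclic V := isCyclic_of_prime_card hV
  have he : V.index ∣ p - 1 := by
    have h : (MulAut.conjNormal (H := V)).ker.index = V.index :=
      congrArg Subgroup.index ((ker_conjNormal V).trans hC)
    rw [← h, Subgroup.index_ker]
    refine (Subgroup.card_subgroup_dvd_card _).trans ?_
    rw [IsCyclic.card_mulAut, hV, Nat.totient_prime hp]
  refine ⟨V.index, Nat.pos_of_ne_zero Subgroup.index_ne_zero_of_finite, he, ?_⟩
  have hcard : Nat.card Y = p * V.index := by rw [← hV, Subgroup.card_mul_index]
  have hpairs : Nat.card { q : Y × Y // Commute q.1 q.2 } =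
      ∑ x : Y, Nat.card (Subgroup.centralizer {x}) := by
    rw [← Nat.card_sigma]
    exact Nat.card_congr
      { toFun := fun q => ⟨q.1.1, q.1.2, Subgroup.mem_centralizer_singleton_iff.2 q.2.symm⟩
        invFun := fun q => ⟨(q.1, q.2.1), (Subgroup.mem_centralizer_singleton_iff.1 q.2.2).symm⟩
        left_inv := fun _ => rfl
        right_inv := fun _ => rfl }
  -- Centralizers have order pe at 1, p on the rest of `V`, and e elsewhere, where e is the index of
  -- `V`. The correction at 1 is added on the left to avoid natural subtraction.
  have hcent : ∀ x : Y, Nat.card (Subgroup.centralizer {x}) + (if x = 1 then p else 0) =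
      (if x = 1 then p * V.index else 0) + (if x ∈ V then p else V.index) := by
    intro x
    by_cases hx1 : x = 1
    · subst hx1
      have : Subgroup.centralizer {(1 : Y)} = ⊤ := by
        rw [eq_top_iff]
        intro y _
        rw [Subgroup.mem_centralizer_singleton_iff, mul_one, one_mul]
      rw [this, Subgroup.card_top, hcard, if_pos rfl, if_pos rfl, if_pos V.one_mem]
    · rw [if_neg hx1, if_neg hx1, add_zero, zero_add]
      by_cases hx : x ∈ V
      · rw [if_pos hx, ← hV]
        congr 2
        refine le_antisymm (fun y hy => ?_) (fun v hv => ?_)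
        · rw [← hC]
          refine Subgroup.mem_centralizer_iff.2 fun w hw => ?_
          obtain ⟨i, hi⟩ := mem_zpowers_of_prime_card hV
            (g := ⟨x, hx⟩) (fun h => hx1 (congrArg Subtype.val h)) (g' := ⟨w, hw⟩)
          have hi' : x ^ i = w := congrArg Subtype.val hi
          rw [← hi']
          exact Commute.zpow_left (Subgroup.mem_centralizer_singleton_iff.1 hy).symm i
        · rw [Subgroup.mem_centralizer_singleton_iff]
          rw [← hC, Subgroup.mem_centralizer_iff] at hv
          exact (hv x hx).symm
      · rw [if_neg hx, card_centralizer_of_notMem hp hV hC hx]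
  have hsum := Finset.sum_congr (rfl : (Finset.univ : Finset Y) = Finset.univ) fun x _ => hcent x
  have hVcard : (Finset.univ.filter fun x => x ∈ V).card = p := by
    rw [← hV, Nat.card_eq_fintype_card, Fintype.card_subtype]
  have hVcard' : (Finset.univ.filter fun x => x ∉ V).card + p = p * V.index := by
    rw [← hcard, Nat.card_eq_fintype_card, ← Finset.card_univ,
      ← Finset.card_filter_add_card_filter_not (s := Finset.univ) (fun x => x ∈ V), hVcard, add_comm]
  rw [Finset.sum_add_distrib, Finset.sum_add_distrib, ← hpairs,
    card_comm_eq_card_conjClasses_mul_card, hcard, Finset.sum_ite_eq', Finset.sum_ite_eq',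
    if_pos (Finset.mem_univ _), if_pos (Finset.mem_univ _), Finset.sum_ite, Finset.sum_const,
    Finset.sum_const, hVcard, smul_eq_mul, smul_eq_mul] at hsum
  have he0 : 0 < V.index := Nat.pos_of_ne_zero Subgroup.index_ne_zero_of_finite
  obtain ⟨f, hf⟩ := he
  rw [hf, Nat.mul_div_cancel_left _ he0]
  have hp1 : p = V.index * f + 1 := by have := hp.one_lt; omega
  refine Nat.eq_of_mul_eq_mul_right (Nat.mul_pos hp.pos he0) ?_
  change classNumber Y * (p * V.index) + p = _ at hsum
  zify at hsum hVcard' hp1 ⊢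
  linear_combination hsum + (V.index : ℤ) * hVcard' + (p : ℤ) * hp1

/-- Schur–Zassenhaus gives a complement `H`, which acts faithfully because `V` is its own
centralizer; `A` is an additive copy of `V` carrying the vector space structure. -/
theorem classNumber_notMem_cyclicSet_of_equiv (hHV : AffineClassNumbers.{u}) {Y : Type u} [Group Y]
    [Finite Y] {V : Subgroup Y} [V.Normal] {p n : ℕ} [hp : Fact p.Prime] {A : Type u}
    [AddCommGroup A] [Module (ZMod p) A] (e : Multiplicative A ≃* V) (hi : ¬ p ∣ V.index)
    (hC : Subgroup.centralizer (V : Set Y) = V) (hn : 2 ≤ n) (hV : Nat.card V = p ^ n) :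
    classNumber Y ∉ cyclicSet p := by
  have hcop : (Nat.card V).Coprime V.index :=
    card_coprime_of_isPGroup (IsPGroup.of_card hV) hi
  obtain ⟨H, hH⟩ := Subgroup.exists_right_complement'_of_coprime hcop
  have hHi : V.index = Nat.card H := hH.symm.index_eq_card
  let ψ : H → (A ≃+ A) := fun h =>
    AddEquiv.toMultiplicative.symm ((e.trans (MulAut.conjNormal (H := V) (h : Y))).trans e.symm)
  have hψ : ∀ h a, (e (Multiplicative.ofAdd (ψ h a)) : Y) =
      h * e (Multiplicative.ofAdd a) * (h : Y)⁻¹ := fun h a => by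
    change (e (e.symm (MulAut.conjNormal (h : Y) (e (Multiplicative.ofAdd a)))) : Y) = _
    rw [MulEquiv.apply_symm_apply, MulAut.conjNormal_apply]
  have hinj : ∀ a b : A, (e (Multiplicative.ofAdd a) : Y) = e (Multiplicative.ofAdd b) → a = b :=
    fun a b hab => Multiplicative.ofAdd.injective (e.injective (Subtype.ext hab))
  let φ : H →* (A ≃ₗ[ZMod p] A) :=
    { toFun := fun h => (ψ h).toLinearEquiv (ZMod.map_smul (ψ h))
      map_one' := LinearEquiv.ext fun a => hinj _ _ ((hψ 1 a).trans (by simp))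
      map_mul' := fun g h => LinearEquiv.ext fun a => hinj _ _ ((hψ (g * h) a).trans
        (Eq.symm ((hψ g (ψ h a)).trans (by rw [hψ h a, Subgroup.coe_mul]; group)))) }
  have hφ : Function.Injective φ := by
    rw [injective_iff_map_eq_one]
    intro h hh
    have h3 : (h : Y) ∈ V := by
      rw [← hC]
      refine Subgroup.mem_centralizer_iff.2 fun v hv => ?_
      have h4 := hψ h (Multiplicative.toAdd (e.symm ⟨v, hv⟩))
      have h5 : ψ h (Multiplicative.toAdd (e.symm ⟨v, hv⟩)) =
          Multiplicative.toAdd (e.symm ⟨v, hv⟩) := LinearEquiv.congr_fun hh _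
      rw [h5, ofAdd_toAdd, MulEquiv.apply_symm_apply] at h4
      exact (mul_inv_eq_iff_eq_mul.1 h4.symm).symm
    exact Subtype.ext (Subgroup.disjoint_def.1 hH.disjoint h3 h.2)
  have : Finite A := Finite.of_equiv V (e.symm.toEquiv.trans Multiplicative.toAdd)
  have hcard : Nat.card A = p ^ n :=
    hV ▸ Nat.card_congr (Multiplicative.ofAdd.trans e.toEquiv)
  have key := hHV p n hp.out hn H A φ hφ (hHi ▸ hi) hcard
  let F : Multiplicative A ⋊[affineAction φ] H →* Y :=
    SemidirectProduct.lift (V.subtype.comp e.toMonoidHom) H.subtype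
      (fun h => MonoidHom.ext fun a => hψ h (Multiplicative.toAdd a))
  have hF : Function.Bijective F := by
    have h1 : Function.Bijective fun q : Multiplicative A × H => ((e q.1 : V) : Y) * q.2 :=
      Function.Bijective.comp hH (e.bijective.prodMap Function.bijective_id)
    exact h1.comp SemidirectProduct.equivProd.bijective
  rwa [← classNumber_congr (MulEquiv.ofBijective F hF).symm] at key

open scoped IsMulCommutative in
theorem classNumber_notMem_cyclicSet (hHV : AffineClassNumbers.{u}) {Y : Type u} [Group Y]
    [Finite Y] {V : Subgroup Y} [V.Normal] [IsMulCommutative V] {p : ℕ} [hp : Fact p.Prime]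
    (hVp : ∀ v ∈ V, v ^ p = 1) (hi : ¬ p ∣ V.index)
    (hC : Subgroup.centralizer (V : Set Y) = V) (h1 : V ≠ ⊥) (h2 : Nat.card V ≠ p) :
    classNumber Y ∉ cyclicSet p := by
  have hVpg : IsPGroup p V := fun v => ⟨1, Subtype.ext (by rw [pow_one]; exact hVp v v.2)⟩
  obtain ⟨n, hn⟩ := hVpg.exists_card_eq
  have hn2 : 2 ≤ n := by
    by_contra hlt
    have h01 : n = 0 ∨ n = 1 := by omega
    rcases h01 with rfl | rfl
    · exact h1 (Subgroup.eq_bot_of_card_eq V (by rw [hn, pow_zero]))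
    · exact h2 (by rw [hn, pow_one])
  let _ : Module (ZMod p) (Additive V) := AddCommGroup.zmodModule fun v =>
    Subtype.ext (hVp v.toMul.1 v.toMul.2)
  exact classNumber_notMem_cyclicSet_of_equiv hHV (A := Additive V)
    { Multiplicative.toAdd.trans Additive.toMul with map_mul' := fun _ _ => rfl } hi hC hn2 hn

end ClassNumbers

/-! ### The count in a group with a normal Sylow subgroup. -/

section Normalizer

theorem isIrreducible_comp_of_surjective {G H V : Type*} [Group G] [Group H] [AddCommGroup V]
    [Module ℂ V] {ρ : Representation ℂ H V} {f : G →* H} (hf : Function.Surjective f) :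
    Representation.IsIrreducible (ρ.comp f : Representation ℂ G V) ↔ ρ.IsIrreducible := by
  rw [isIrreducible_iff, isIrreducible_iff]
  refine and_congr_right fun _ => forall_congr' fun W => ?_
  refine imp_congr_left ⟨fun h g => ?_, fun h g => h (f g)⟩
  obtain ⟨g, rfl⟩ := hf g
  exact h g

/-- `P` is a nontrivial normal Sylow `p`-subgroup of `N`, and `K` is a normal `p'`-subgroup such
that the centralizer of `P` is contained in `PK`. -/
structure NormalSylowData (p : ℕ) {N : Type*} [Group N] (P K : Subgroup N) : Prop where
  isPGroup : IsPGroup p P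
  not_dvd_index : ¬ p ∣ P.index
  ne_bot : P ≠ ⊥
  not_dvd_card : ¬ p ∣ Nat.card K
  centralizer : ∀ x ∈ Subgroup.centralizer (P : Set N), ∃ z ∈ P, ∃ k ∈ K, x = z * k

namespace NormalSylowData

variable {p : ℕ} {N : Type*} [Group N] {P K : Subgroup N}

/-- `P` meets `K` trivially, so passing to the quotient by KΦ cuts `P` down exactly to P/Φ. -/
theorem mem_commPowSubgroup [Fact p.Prime] [Finite N] [K.Normal]
    (h : NormalSylowData p P K) {x : N} (hxP : x ∈ P)
    (hx : x ∈ K ⊔ commPowSubgroup p P) : x ∈ commPowSubgroup p P := by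
  obtain ⟨k, hk, d, hd, rfl⟩ := Subgroup.mem_sup_of_normal_left.1 hx
  have hkP : k ∈ P := (Subgroup.mul_mem_cancel_right P (commPowSubgroup_le P hd)).1 hxP
  have h1 : k = 1 := by
    have h2 := Subgroup.disjoint_of_coprime_natCard
      (card_coprime_of_isPGroup h.isPGroup h.not_dvd_card)
    exact Subgroup.disjoint_def.1 h2 hkP hk
  rwa [h1, one_mul]

theorem apply_eq_one_of_isAlmostRational [hp : Fact p.Prime] [Finite N] [P.Normal]
    (h : NormalSylowData p P K) {V : Type*} [AddCommGroup V]
    [Module ℂ V] [FiniteDimensional ℂ V] {ρ : Representation ℂ N V} (hρ : ρ.IsIrreducible)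
    (hd : ¬ p ∣ finrank ℂ V) (ha : IsAlmostRational p ρ.character) {x : N}
    (hx : x ∈ commPowSubgroup p P) : ρ x = 1 := by
  obtain ⟨c, hc⟩ := h.isPGroup.exists_card_eq
  obtain ⟨b, rfl⟩ : ∃ b, c = b + 1 := Nat.exists_eq_succ_of_ne_zero fun h0 =>
    h.ne_bot (Subgroup.eq_bot_of_card_eq P (by rw [hc, h0, pow_zero]))
  obtain ⟨k, hk, F, τ, hτ1, hτ2⟩ := exists_ringHom_of_isAlmostRational hp.out ha b
  obtain ⟨l, hl, hlp⟩ := exists_weight_pow_eq_one hρ hc h.not_dvd_index hd hk fun l =>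
    finrank_weightSpace_pow (ρ.comp P.subtype) l τ k (fun x => hτ1 x) (by rwa [hc])
  obtain ⟨v, hv, hv0⟩ := Submodule.exists_mem_ne_zero_of_ne_bot hl
  refine apply_eq_one_of_weightSpace_one hρ (K := commPowSubgroup p P) (fun h0 => hv0 ?_) hx
  rw [← Submodule.mem_bot ℂ, ← h0]
  -- A linear character with `p`-th power 1 kills commutators and `p`-th powers, so its eigenvector
  -- is fixed by the normal subgroup Φ.
  have hD : commPowSubgroup p P ≤ (l.ker).map P.subtype := by
    rw [commPowSubgroup, Subgroup.closure_le]
    rintro x ⟨a, ha, b, hb, rfl | rfl⟩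
    · refine ⟨⟨a, ha⟩ * ⟨b, hb⟩ * ⟨a, ha⟩⁻¹ * ⟨b, hb⟩⁻¹, ?_, rfl⟩
      rw [SetLike.mem_coe, MonoidHom.mem_ker]
      simp only [map_mul]
      linear_combination l ⟨b, hb⟩⁻¹ * l ⟨b, hb⟩ * apply_inv_mul_apply l ⟨a, ha⟩ +
        apply_inv_mul_apply l ⟨b, hb⟩
    · exact ⟨⟨a, ha⟩ ^ p, by rw [SetLike.mem_coe, MonoidHom.mem_ker, map_pow, hlp], rfl⟩
  intro d
  obtain ⟨y, hy, hyd⟩ := hD d.2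
  have h1 := hv y
  rw [MonoidHom.mem_ker.1 hy] at h1
  rw [MonoidHom.one_apply, ← h1]
  simp only [MonoidHom.comp_apply, Subgroup.coe_subtype]
  rw [← hyd]
  rfl

variable [hPn : P.Normal] [hKn : K.Normal]

/-- The image of the Sylow subgroup in the quotient by `K` and the non-generators. -/
abbrev quot (p : ℕ) (P K : Subgroup N) [P.Normal] [K.Normal] :
    Subgroup (N ⧸ (K ⊔ commPowSubgroup p P)) :=
  P.map (QuotientGroup.mk' (K ⊔ commPowSubgroup p P))

instance quot_normal : (quot p P K).Normal :=
  hPn.map _ (QuotientGroup.mk'_surjective _)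

theorem not_dvd_index_quot (h : NormalSylowData p P K) : ¬ p ∣ (quot p P K).index := fun hd =>
  h.not_dvd_index (hd.trans (P.index_map_dvd (QuotientGroup.mk'_surjective _)))

theorem pow_eq_one_of_mem_quot {v : N ⧸ (K ⊔ commPowSubgroup p P)} (hv : v ∈ quot p P K) :
    v ^ p = 1 := by
  obtain ⟨a, ha, rfl⟩ := hv
  rw [← map_pow, QuotientGroup.mk'_apply, QuotientGroup.eq_one_iff]
  exact (le_sup_right : commPowSubgroup p P ≤ _) (pow_mem_commPowSubgroup ha)

theorem mul_comm_of_mem_quot {v w : N ⧸ (K ⊔ commPowSubgroup p P)} (hv : v ∈ quot p P K)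
    (hw : w ∈ quot p P K) : v * w = w * v := by
  obtain ⟨a, ha, rfl⟩ := hv
  obtain ⟨b, hb, rfl⟩ := hw
  rw [← mul_inv_eq_iff_eq_mul, ← mul_inv_eq_one, ← map_inv, ← map_inv, ← map_mul, ← map_mul,
    ← map_mul, QuotientGroup.mk'_apply, QuotientGroup.eq_one_iff]
  exact (le_sup_right : commPowSubgroup p P ≤ _) (commutator_mem_commPowSubgroup ha hb)

instance quot_comm : IsMulCommutative (quot p P K) :=
  ⟨⟨fun v w => Subtype.ext (mul_comm_of_mem_quot v.2 w.2)⟩⟩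

theorem isPGroup_quot : IsPGroup p (quot p P K) :=
  fun v => ⟨1, Subtype.ext (by rw [pow_one]; exact pow_eq_one_of_mem_quot v.2)⟩

variable [hp : Fact p.Prime] [Finite N]

/-- An element centralizing P/Φ in the quotient acts trivially on `P` modulo Φ, so coprime action
places it in PK, whose image is that of `P`. -/
theorem centralizer_quot (h : NormalSylowData p P K) :
    Subgroup.centralizer (quot p P K : Set (N ⧸ (K ⊔ commPowSubgroup p P))) = quot p P K := by
  refine le_antisymm (fun y hy => ?_) (fun v hv => ?_)
  · obtain ⟨x, rfl⟩ := QuotientGroup.mk_surjective y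
    have h1 : x ∈ P ⊔ K := mem_sup_of_conj_mem_commPowSubgroup h.isPGroup h.not_dvd_index
      h.centralizer fun a ha => by
        refine h.mem_commPowSubgroup (P.mul_mem (P.inv_mem ha) (hPn.conj_mem a ha x)) ?_
        have h2 := Subgroup.mem_centralizer_iff.1 hy _ ⟨a, ha, rfl⟩
        rw [← QuotientGroup.eq_one_iff]
        rw [QuotientGroup.mk'_apply] at h2
        rw [QuotientGroup.mk_mul, QuotientGroup.mk_mul, QuotientGroup.mk_mul, QuotientGroup.mk_inv,
          QuotientGroup.mk_inv, ← h2]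
        group
    obtain ⟨z, hz, k, hk, rfl⟩ := Subgroup.mem_sup_of_normal_left.1 h1
    refine ⟨z, hz, ?_⟩
    rw [QuotientGroup.mk'_apply, QuotientGroup.eq]
    rw [inv_mul_cancel_left]
    exact (le_sup_left : K ≤ _) hk
  · exact Subgroup.mem_centralizer_iff.2 fun w hw => mul_comm_of_mem_quot hw hv

theorem quot_ne_bot (h : NormalSylowData p P K) : quot p P K ≠ ⊥ := by
  intro h0
  refine h.ne_bot (eq_of_forall_eq_mul_commPowSubgroup h.isPGroup bot_le fun x hx => ?_).symm
  refine ⟨1, one_mem _, x, h.mem_commPowSubgroup hx ?_, (one_mul x).symm⟩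
  have h1 : QuotientGroup.mk' (K ⊔ commPowSubgroup p P) x ∈ quot p P K := ⟨x, hx, rfl⟩
  rwa [h0, Subgroup.mem_bot, QuotientGroup.mk'_apply, QuotientGroup.eq_one_iff] at h1

/-- Burnside's basis argument: a lift of a generator of P/Φ generates `P`, since Φ consists of
non-generators. -/
theorem isCyclic_iff (h : NormalSylowData p P K) : IsCyclic P ↔ Nat.card (quot p P K) = p := by
  constructor
  · intro hc
    obtain ⟨g, hg⟩ := hc.exists_generator
    have h1 : quot p P K = Subgroup.zpowers (QuotientGroup.mk' _ g.1) := by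
      refine le_antisymm ?_ ?_
      · rintro _ ⟨a, ha, rfl⟩
        obtain ⟨i, hi⟩ := hg ⟨a, ha⟩
        have hi' : g.1 ^ i = a := congrArg Subtype.val hi
        exact ⟨i, by rw [← hi']; exact (map_zpow _ _ _).symm⟩
      · rw [Subgroup.zpowers_le]
        exact ⟨g, g.2, rfl⟩
    have h2 : Nat.card (quot p P K) ∣ p := by
      rw [h1, Nat.card_zpowers]
      exact orderOf_dvd_of_pow_eq_one (pow_eq_one_of_mem_quot ⟨g, g.2, rfl⟩)
    exact ((Nat.dvd_prime hp.out).1 h2).resolve_left fun h3 =>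
      h.quot_ne_bot (Subgroup.eq_bot_of_card_eq _ h3)
  · intro hc
    have hcyc : IsCyclic (quot p P K) := isCyclic_of_prime_card hc
    obtain ⟨⟨_, a, ha, rfl⟩, hg⟩ := hcyc.exists_generator
    have h1 := eq_of_forall_eq_mul_commPowSubgroup h.isPGroup (C := Subgroup.zpowers a)
      (by rw [Subgroup.zpowers_le]; exact ha) (fun x hx => by
        obtain ⟨i, hi⟩ := hg ⟨_, x, hx, rfl⟩
        have hi' : (QuotientGroup.mk' (K ⊔ commPowSubgroup p P) a) ^ i =
          QuotientGroup.mk' (K ⊔ commPowSubgroup p P) x := congrArg Subtype.val hi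
        refine ⟨a ^ i, ⟨i, rfl⟩, (a ^ i)⁻¹ * x, h.mem_commPowSubgroup
          (P.mul_mem (P.inv_mem (P.zpow_mem ha i)) hx) ?_, (mul_inv_cancel_left _ _).symm⟩
        rw [← QuotientGroup.eq, ← QuotientGroup.mk'_apply, ← QuotientGroup.mk'_apply, map_zpow, hi'])
    rw [← h1]
    infer_instance

/-- The almost `p`-rational characters of degree prime to `p` in the principal block of a group
with a normal Sylow `p`-subgroup. -/
theorem primeToRatBlock_eq (h : NormalSylowData p P K) :
    primeToRatBlock p N =
      (fun χ x => χ (QuotientGroup.mk' (K ⊔ commPowSubgroup p P) x)) ''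
        Irr (N ⧸ (K ⊔ commPowSubgroup p P)) := by
  ext χ
  constructor
  · rintro ⟨⟨⟨⟨n, ρ, hρ, rfl⟩, hB⟩, d, hd, hpd⟩, ha⟩
    have hd' : ¬ p ∣ finrank ℂ (Fin n → ℂ) := by
      rw [Representation.char_one, Nat.cast_inj] at hd
      rwa [hd]
    have hker : K ⊔ commPowSubgroup p P ≤ MonoidHom.ker ρ := sup_le
      (fun x hx => apply_eq_one_of_sameBlock hρ hp.out hB h.not_dvd_card hx)
      (fun x hx => h.apply_eq_one_of_isAlmostRational hρ hd' ha hx)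
    let ρ' : Representation ℂ (N ⧸ (K ⊔ commPowSubgroup p P)) (Fin n → ℂ) :=
      QuotientGroup.lift _ ρ hker
    refine ⟨ρ'.character, ⟨n, ρ', ?_, rfl⟩, rfl⟩
    rw [← isIrreducible_comp_of_surjective (QuotientGroup.mk'_surjective _)]
    exact hρ
  · rintro ⟨_, ⟨n, ρ', hρ', rfl⟩, rfl⟩
    let ρ : Representation ℂ N (Fin n → ℂ) := ρ'.comp (QuotientGroup.mk' _)
    have hρ : ρ.IsIrreducible :=
      (isIrreducible_comp_of_surjective (QuotientGroup.mk'_surjective _)).2 hρ'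
    -- The Sylow subgroup of the quotient is abelian, so every irreducible degree there is prime to
    -- `p`.
    have hd := not_dvd_finrank_of_comm hρ' isPGroup_quot h.not_dvd_index_quot
    refine ⟨⟨⟨⟨n, ρ, hρ, rfl⟩, ?_⟩, _, Representation.char_one ρ, hd⟩, ?_⟩
    · refine sameBlock_one_of_apply_eq_one hρ h.isPGroup hd fun x hx => ?_
      obtain ⟨z, hz, k, hk, rfl⟩ := h.centralizer x hx
      refine ⟨z, hz, k, ?_, rfl⟩
      have : QuotientGroup.mk' (K ⊔ commPowSubgroup p P) k = 1 :=
        (QuotientGroup.eq_one_iff k).2 ((le_sup_left : K ≤ _) hk)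
      change ρ' (QuotientGroup.mk' _ k) = 1
      rw [this, map_one]
    · have : NeZero (p * (quot p P K).index) :=
        ⟨mul_ne_zero hp.out.ne_zero Subgroup.index_ne_zero_of_finite⟩
      -- The exponent of the quotient divides `p` times the index of its Sylow subgroup, a number
      -- not divisible by p².
      refine ⟨p * (quot p P K).index, NeZero.pos _, fun h2 => h.not_dvd_index_quot ?_, fun x => ?_⟩
      · rw [pow_two] at h2
        exact Nat.dvd_of_mul_dvd_mul_left hp.out.pos h2
      · refine character_mem_cycField ⟨n, ρ', hρ', rfl⟩ ?_
        rw [pow_mul', pow_eq_one_of_mem_quot (Subgroup.pow_index_mem _ _)]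

theorem isCyclic_iff_ncard_mem (hHV : AffineClassNumbers.{u}) {N : Type u} [Group N] [Finite N]
    {P K : Subgroup N} [P.Normal] [K.Normal] (h : NormalSylowData p P K) :
    IsCyclic P ↔ (primeToRatBlock p N).ncard ∈ cyclicSet p := by
  have hinj : Function.Injective (fun (χ : N ⧸ (K ⊔ commPowSubgroup p P) → ℂ) x =>
      χ (QuotientGroup.mk' (K ⊔ commPowSubgroup p P) x)) :=
    (QuotientGroup.mk'_surjective _).injective_comp_right
  rw [h.isCyclic_iff, h.primeToRatBlock_eq, Set.ncard_image_of_injective _ hinj,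
    ← Nat.card_coe_set_eq, card_Irr]
  refine ⟨fun hc => classNumber_mem_cyclicSet hp.out hc h.centralizer_quot, fun hc => ?_⟩
  by_contra hne
  exact classNumber_notMem_cyclicSet hHV (fun v hv => pow_eq_one_of_mem_quot hv)
    h.not_dvd_index_quot h.centralizer_quot h.quot_ne_bot hne hc

end NormalSylowData

end Normalizer

/-! ### Passing from the group to the Sylow normalizer. -/

section Transport

/-- The Alperin–McKay–Navarro bijection restricts to almost `p`-rational characters. -/
theorem ncard_primeToRatBlock_normalizer (hAMN : PrincipalBlockAMN.{u}) {G : Type u} [Group G]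
    [Finite G] {p : ℕ} (hp : p.Prime) (hdvd : p ∣ Nat.card G) (P : Sylow p G) :
    (primeToRatBlock p G).ncard =
      (primeToRatBlock p (Subgroup.normalizer ((P : Subgroup G) : Set G))).ncard := by
  obtain ⟨f, hf⟩ := hAMN G p hp P
  obtain ⟨c, m, hpm, hG⟩ := Nat.exists_eq_pow_mul_and_not_dvd (Nat.card_pos (α := G)).ne' p hp.ne_one
  obtain ⟨a, rfl⟩ : ∃ a, c = a + 1 := Nat.exists_eq_succ_of_ne_zero fun h0 => hpm (by
    rwa [hG, h0, pow_zero, one_mul] at hdvd)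
  have hm : m ≠ 0 := fun h => hpm (h ▸ dvd_zero p)
  -- The field depends on |G|, so the order is generalized before being replaced by p^(a+1)m.
  have hf' : ∀ L, Nat.card G = L → ∀ σ ∈ navarroGroup p L, ∀ χ χ',
      IsGaloisConj σ χ.1 χ'.1 ↔ IsGaloisConj σ (f χ).1 (f χ').1 := by
    rintro L rfl
    exact hf
  have hL : NeZero (p ^ (a + 1) * m) := ⟨mul_ne_zero (pow_ne_zero _ hp.ne_zero) hm⟩
  have key : ∀ χ : primeToBlock p G, IsAlmostRational p χ.1 ↔ IsAlmostRational p (f χ).1 := by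
    intro χ
    rw [isAlmostRational_iff hp hm hpm fun x => character_mem_cycField χ.2.1.1 (hG ▸ pow_card_eq_one'),
      isAlmostRational_iff hp hm hpm fun x => character_mem_cycField (f χ).2.1.1
        (Subtype.ext (by rw [Subgroup.coe_pow, ← hG, pow_card_eq_one']; rfl))]
    -- Equivariance with both characters equal to χ says that σ fixes χ exactly when it fixes its
    -- image.
    exact forall₂_congr fun σ hσ => hf' _ hG σ (fixingRoots_subset_navarroGroup hp hm hσ) χ χ
  have hset : ∀ {X : Type u} [Group X], Nat.card (primeToRatBlock p X) =
      Nat.card {χ : primeToBlock p X // IsAlmostRational p χ.1} := fun {X} _ =>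
    Nat.card_congr (Equiv.subtypeSubtypeEquivSubtypeInter _ _).symm
  rw [← Nat.card_coe_set_eq, ← Nat.card_coe_set_eq, hset, hset]
  exact Nat.card_congr (f.subtypeEquiv key)

end Transport

end AlmostRational

end

theorem mainTheorem12
    (hHV : AlmostRational.AffineClassNumbers.{u})
    (hAMN : AlmostRational.PrincipalBlockAMN.{u})
    (G : Type u) [Group G] [Finite G] (p : ℕ) (hp : p.Prime) (hdvd : p ∣ Nat.card G) :
    (∀ P : Sylow p G, IsCyclic P) ↔
      (AlmostRational.primeToRatBlock p G).ncard ∈ AlmostRational.cyclicSet p := by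
  have := Fact.mk hp
  obtain ⟨P⟩ : Nonempty (Sylow p G) := inferInstance
  have hall : (∀ Q : Sylow p G, IsCyclic Q) ↔ IsCyclic P :=
    ⟨fun h => h P, fun h Q => (P.equiv Q).isCyclic.1 h⟩
  let N := Subgroup.normalizer ((P : Subgroup G) : Set G)
  have hPN : (P : Subgroup G) ≤ N := Subgroup.le_normalizer
  have hn : ((P : Subgroup G).subgroupOf N).Normal := Subgroup.normal_in_normalizer
  have hPg : IsPGroup p ((P : Subgroup G).subgroupOf N) :=
    P.isPGroup'.comap_of_injective N.subtype N.subtype_injective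
  have hi : ¬ p ∣ ((P : Subgroup G).subgroupOf N).index := fun h =>
    P.not_dvd_index (h.trans (Subgroup.relIndex_dvd_index_of_le hPN))
  obtain ⟨K, hK, hKc, hC⟩ := AlmostRational.exists_normal_complement_centralizer hPg hi
  have hne : (P : Subgroup G).subgroupOf N ≠ ⊥ := fun h =>
    P.ne_bot_of_dvd_card hdvd (by
      rwa [Subgroup.subgroupOf_eq_bot, disjoint_of_le_iff_left_eq_bot hPN] at h)
  rw [hall, AlmostRational.ncard_primeToRatBlock_normalizer hAMN hp hdvd P,
    ← AlmostRational.NormalSylowData.isCyclic_iff_ncard_mem hHV ⟨hPg, hi, hne, hKc, hC⟩]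
  exact (Subgroup.subgroupOfEquivOfLe hPN).symm.isCyclic
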